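/- Identify $\mathbb{R}^2$ with $\mathbb{C}$, let $\zeta_5=e^{2\pi i/5}$ and $\tau=(1+\sqrt5)/2$. Every $z\in\mathbb{Z}[\zeta_5]$ is uniquely $z=\sum_{j=0}^{3}a_j(z)\zeta_5^{\,j}$ with $a_j(z)\in\mathbb{Z}$; put $$z^\star=\Big(\sum_{j=0}^{3}a_j(z)\,\zeta_5^{\,2j},\ \sum_{j=0}^{3}a_j(z)\bmod 5\Big)\in\mathbb{R}^2\times\mathbb{Z}/5\mathbb{Z},$$ where $\mathbb{Z}/5\mathbb{Z}$ is discrete. Let $P$ be the convex hull of the fifth roots of unity (a regular pentagon), and let $(W^{(1)},W^{(2)},W^{(3)},W^{(4)})=(P,-\tau P,\tau P,-P)$. Put $W_P=\bigcup_{j=1}^{4}W^{(j)}\times\{j \bmod 5\}$ and, for $u\in\mathbb{R}^2$, $W_P^u=(u,0)+W_P$. If the boundary of $W_P^u$ contains no point $z^\star$ with $z\in\mathbb{Z}[\zeta_5]$, then every set $t+\{z\in\mathbb{Z}[\zeta_5] : z^\star\in W_P^u\}$ with $t\in\mathbb{R}^2$ is called a *Penrose model set*. For a Penrose model set $\Lambda$,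 let $\mathcal{C}(\Lambda)$ be the collection of all finite $C\subset\Lambda$ with $C=\operatorname{conv}(C)\cap\Lambda$. A direction $u\in\mathbb{S}^1$ is a *$\mathbb{Z}[\zeta_5]$-direction* if it is parallel to a nonzero element of $\mathbb{Z}[\zeta_5]$. The *X-ray* $X_uF$ of a finite set $F\subset\mathbb{R}^2$ is the function that assigns to each line $\ell$ parallel to $u$ the number of points of $F\cap\ell$. A collection $\mathcal{E}$ of finite sets is *determined by the X-rays in the directions of* $U\subset\mathbb{S}^1$ if, for all $F,F'\in\mathcal{E}$, $X_uF=X_uF'$ for all $u\in U$ implies $F=F'$. **Theorem.** (i) There is a set $U\subset\mathbb{S}^1$ of four pairwise non-parallel $\mathbb{Z}[\zeta_5]$-directions such that, for every Penrose model set $\Lambda$, the collection $\mathcal{C}(\Lambda)$ is determined by the X-rays in the directions of $U$. For example, the set of the four directions $z/|z|$ with $$z\in\{(1+\tau)+\zeta_5,\ (\tau-1)+\zeta_5,\ -\tau+\zeta_5,\ 2\tau-\zeta_5\}$$ has this property. (ii) For every Penrose model set $\Lambda$ and every set $U\subset\mathbb{S}^1$ of three or fewer pairwise non-parallel $\mathbb{Z}[\zeta_5]$-directions,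 $\mathcal{C}(\Lambda)$ is not determined by the X-rays in the directions of $U$. Both parts hold equally for the sets obtained in the same way from the labelling $(W^{(1)},W^{(2)},W^{(3)},W^{(4)})=(P,-P,\tau P,-\tau P)$ of the four pentagons, in place of $(P,-\tau P,\tau P,-P)$, with the same set of four directions in the example. -/

import Mathlib

open scoped Pointwise

namespace Penrose

noncomputable section

/-! The Euclidean plane is identified with `ℂ` throughout. -/

/-- The primitive fifth root of unity `ζ₅ = exp (2πi/5)`. -/
def zeta5 : ℂ := Complex.exp (2 * Real.pi * Complex.I / 5)

/-- The ring `ℤ[ζ₅]` of cyclotomic integers. -/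
def Zzeta5 : Subalgebra ℤ ℂ := Algebra.adjoin ℤ {zeta5}

/-- The element `∑ aⱼ ζ₅ʲ` (`0 ≤ j ≤ 3`) of `ℤ[ζ₅]` with integer coordinates `a`. Every element of
`ℤ[ζ₅]` has exactly one such representation (`coordElt_injective` and `range_coordElt`). -/
def coordElt (a : Fin 4 → ℤ) : ℂ := ∑ j : Fin 4, (a j : ℂ) * zeta5 ^ (j : ℕ)

lemma zeta5_isPrimitiveRoot : IsPrimitiveRoot zeta5 5 := by
  have h := Complex.isPrimitiveRoot_exp 5 (by norm_num)
  simpa [zeta5] using h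

lemma zeta5_pow_four : zeta5 ^ 4 = -1 - zeta5 - zeta5 ^ 2 - zeta5 ^ 3 := by
  have h := zeta5_isPrimitiveRoot.geom_sum_eq_zero (by norm_num)
  simp only [Finset.sum_range_succ, Finset.sum_range_zero] at h
  linear_combination h

lemma coordElt_injective : Function.Injective coordElt := by
  have hz := zeta5_isPrimitiveRoot
  have hdeg : (minpoly ℤ zeta5).natDegree = 4 := by
    rw [← Polynomial.cyclotomic_eq_minpoly hz (by norm_num), Polynomial.natDegree_cyclotomic]
    decide
  intro a b hab
  set p : Polynomial ℤ := ∑ j : Fin 4, Polynomial.C (a j - b j) * Polynomial.X ^ (j : ℕ) with hp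
  have h0 : Polynomial.aeval zeta5 p = 0 := by
    have h1 : coordElt a - coordElt b = 0 := sub_eq_zero.mpr hab
    rw [← h1, hp, coordElt, coordElt, ← Finset.sum_sub_distrib, map_sum]
    refine Finset.sum_congr rfl fun j _ => ?_
    simp
    ring
  have hdvd := minpoly.isIntegrallyClosed_dvd (hz.isIntegral (by norm_num)) h0
  have hp0 : p = 0 := by
    by_contra hne
    have h2 := Polynomial.natDegree_le_of_dvd hdvd hne
    have h3 : p.natDegree ≤ 3 := by
      refine Polynomial.natDegree_sum_le_of_forall_le _ _ fun j _ => ?_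
      exact (Polynomial.natDegree_C_mul_X_pow_le _ _).trans (by omega)
    omega
  funext j
  have h4 : p.coeff (j : ℕ) = a j - b j := by
    rw [hp, Polynomial.finsetSum_coeff]
    simp only [Polynomial.coeff_C_mul, Polynomial.coeff_X_pow, Fin.val_inj]
    simp
  rw [hp0, Polynomial.coeff_zero] at h4
  omega

lemma range_coordElt : Set.range coordElt = (Zzeta5 : Set ℂ) := by
  have hz : zeta5 ∈ Zzeta5 := Algebra.subset_adjoin rfl
  apply Set.Subset.antisymm
  · rintro _ ⟨a, rfl⟩
    exact sum_mem fun j _ => mul_mem (intCast_mem _ _) (pow_mem hz _)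
  · intro x hx
    rw [SetLike.mem_coe, Zzeta5, Algebra.adjoin_singleton_eq_range_aeval] at hx
    obtain ⟨f, rfl⟩ := hx
    change Polynomial.aeval zeta5 f ∈ Set.range coordElt
    induction f using Polynomial.induction_on with
    | C n =>
      refine ⟨![n, 0, 0, 0], ?_⟩
      simp [coordElt, Fin.sum_univ_four]
    | add f g hf hg =>
      obtain ⟨a, ha⟩ := hf
      obtain ⟨b, hb⟩ := hg
      refine ⟨a + b, ?_⟩
      rw [map_add, ← ha, ← hb, coordElt, coordElt, coordElt, ← Finset.sum_add_distrib]
      refine Finset.sum_congr rfl fun j _ => ?_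
      simp
      ring
    | monomial n m h =>
      obtain ⟨a, ha⟩ := h
      refine ⟨![-a 3, a 0 - a 3, a 1 - a 3, a 2 - a 3], ?_⟩
      rw [pow_succ, ← mul_assoc, map_mul, ← ha, Polynomial.aeval_X]
      simp [coordElt, Fin.sum_univ_four]
      linear_combination (-(a 3 : ℂ)) * zeta5_pow_four

/-- The star map `z ↦ z⋆ = (σ₂(z), ∑ aⱼ(z) mod 5)` with values in `ℝ² × ℤ/5ℤ`, written in the
coordinates `a` of `z`. Here `σ₂` is the field automorphism with `ζ₅ ↦ ζ₅²`, so that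
`σ₂(∑ aⱼ ζ₅ʲ) = ∑ aⱼ (ζ₅²)ʲ`. -/
def starMap (a : Fin 4 → ℤ) : ℂ × ZMod 5 :=
  (∑ j : Fin 4, (a j : ℂ) * (zeta5 ^ 2) ^ (j : ℕ), ∑ j : Fin 4, (a j : ZMod 5))

/-- `Λ(W) = {z ∈ ℤ[ζ₅] | z⋆ ∈ W}`. -/
def modelSet (W : Set (ℂ × ZMod 5)) : Set ℂ :=
  {z | ∃ a : Fin 4 → ℤ, z = coordElt a ∧ starMap a ∈ W}

/-- The regular pentagon `P`, the convex hull of the fifth roots of unity. -/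
def pentagon : Set ℂ := convexHull ℝ {z : ℂ | z ^ 5 = 1}

/-- The pentagons `W⁽¹⁾, …, W⁽⁴⁾` whose model sets are the vertex sets of Penrose tilings
(the entry with index `j : Fin 4` is `W⁽ʲ⁺¹⁾`). -/
def pentagons : Fin 4 → Set ℂ :=
  ![pentagon, -(Real.goldenRatio • pentagon), Real.goldenRatio • pentagon, -pentagon]

/-- The same four pentagons with `W⁽²⁾` and `W⁽⁴⁾` interchanged, another labelling
found in the literature. -/
def pentagons' : Fin 4 → Set ℂ :=
  ![pentagon, -pentagon, Real.goldenRatio • pentagon, -(Real.goldenRatio • pentagon)]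

/-- The window `W_P = ⋃ⱼ W⁽ʲ⁾ × {j mod 5}`, `j = 1, …, 4`. -/
def window (W : Fin 4 → Set ℂ) : Set (ℂ × ZMod 5) :=
  ⋃ j : Fin 4, W j ×ˢ {(((j : ℕ) + 1 : ℕ) : ZMod 5)}

/-- The shifted window `W_P^u = (u, 0) + W_P`. -/
def shiftedWindow (W : Fin 4 → Set ℂ) (u : ℂ) : Set (ℂ × ZMod 5) :=
  (fun p => (u, 0) + p) '' window W

/-- `u` is generic: the boundary of `W_P^u` (in the product topology of `ℝ² × ℤ/5ℤ`, with
`ℤ/5ℤ` discrete) contains no point of `ℤ[ζ₅]⋆`. -/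
def IsGeneric (W : Fin 4 → Set ℂ) (u : ℂ) : Prop :=
  frontier (shiftedWindow W u) ∩ Set.range starMap = ∅

/-- Penrose model sets: all translates `t + Λ(W_P^u)` with `u` generic. -/
def IsPenroseModelSet (W : Fin 4 → Set ℂ) (Λ : Set ℂ) : Prop :=
  ∃ t u : ℂ, IsGeneric W u ∧ Λ = (fun z => t + z) '' modelSet (shiftedWindow W u)

/-- The convex sets in `Λ`: the finite `C ⊆ Λ` with `C = conv(C) ∩ Λ`. -/
def convexSubsets (Λ : Set ℂ) : Set (Set ℂ) :=
  {C | C.Finite ∧ C ⊆ Λ ∧ C = convexHull ℝ C ∩ Λ}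

/-- `w` and `z` are parallel: one is a nonzero real multiple of the other. -/
def Parallel (w z : ℂ) : Prop := ∃ r : ℝ, r ≠ 0 ∧ w = (r : ℂ) * z

/-- A direction `u` in the unit circle is a `ℤ[ζ₅]`-direction if it is parallel to a nonzero
element of `ℤ[ζ₅]`. -/
def IsZzeta5Direction (u : Circle) : Prop := ∃ z ∈ Zzeta5, z ≠ 0 ∧ Parallel u z

/-- `U` is a set of pairwise non-parallel `ℤ[ζ₅]`-directions. -/
def NonparallelZzeta5Directions (U : Set Circle) : Prop :=
  (∀ u ∈ U, IsZzeta5Direction u) ∧ U.Pairwise fun u v => ¬ Parallel (u : ℂ) (v : ℂ)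

/-- The set of lines `p + ℝu` in direction `u`. -/
def linesInDirection (u : Circle) : Set (Set ℂ) :=
  {l | ∃ p : ℂ, l = {z | ∃ s : ℝ, z = p + (s : ℂ) * (u : ℂ)}}

/-- The X-ray `X_u F` of a finite set `F`: the number of points of `F` on each line in
direction `u`. -/
def xray (u : Circle) (F : Set ℂ) : linesInDirection u → ℕ :=
  fun l => (F ∩ (l : Set ℂ)).ncard

/-- The collection `E` of finite sets is determined by the X-rays in the directions of `U`. -/
def Determined (E : Set (Set ℂ)) (U : Set Circle) : Prop :=
  ∀ F ∈ E, ∀ F' ∈ E, (∀ u ∈ U, xray u F = xray u F') → F = F'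

/-- The four elements `(1+τ)+ζ₅`, `(τ-1)+ζ₅`, `-τ+ζ₅`, `2τ-ζ₅` of `ℤ[ζ₅]`, with `τ` the golden
ratio. -/
def fourElements : Set ℂ :=
  {(1 + (Real.goldenRatio : ℂ)) + zeta5, ((Real.goldenRatio : ℂ) - 1) + zeta5,
    -(Real.goldenRatio : ℂ) + zeta5, 2 * (Real.goldenRatio : ℂ) - zeta5}

/-- The directions `z / |z|` of the above four elements `z`. -/
def fourDirections : Set Circle :=
  {u | ∃ z ∈ fourElements, (u : ℂ) = z / (‖z‖ : ℂ)}

end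

end Penrose

/-!
**Uniqueness.** Let `F ≠ F'` be convex subsets with the same X-rays in the four directions. A line
in one of these directions meets `F \ F'` and `F' \ F` in equally many points, and by convexity no
point of one set lies between two points of the other. Hence every direction gives a sign-changing matching
of the points of `D = (F \ F') ∪ (F' \ F)` along its lines. Read clockwise, the signs of the points
of `D` form `M` blocks of alternating sign, where `M` is even, and every direction acts on the
numbers of the blocks as a reflection `i ↦ c - i` of `ℤ/M`. To avoid angles and connected components,
the blocks are counted along the lines of one direction (`sideKey`, `IsBlockIndex`); comparing two
directions only needs that no point lies in the hull of three points of opposite sign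
(`NoMixedHull`, `IsBlockIndex.exists_add_matching`).

Take the first Fourier moment `a = ∑ p ωᶠ⁽ᵖ⁾ ∈ ℂ²` over the points `p ∈ D`, with `ω = exp (2πi/M)`
and `f p` the block of `p`. The matching in the direction `j` says that `a - εⱼ a̅` is a complex
multiple of that direction, where `εⱼ = ω ^ cⱼ`. The vectors `a` and `a̅` are linearly independent
(`IsBlockIndex.exists_sum_ne_zero`, `IsBlockIndex.not_forall_add`), so the cross ratio of the four
directions is the cross ratio of the roots of unity `ε₀, …, ε₃` (`no_matching_four`). For the
directions at hand that cross ratio is divisible by the prime `3 τ - 1` of norm `-11`, whereas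
`1 - η` has `11`-adic valuation at most `1 / 10` for each root of unity `η ≠ 1`
(`crossRatio_ne`). The argument applies to convex subsets of any set of points in the plane.

**Non-uniqueness.** For at most three directions there are `z₀, z₁, z₂ ∈ ℤ[ζ₅]` with sum `0` that are
parallel to them (`exists_sum_eq_zero`). The hexagon with vertices `c ± zᵢ` has all its sides and long
diagonals in these directions, so removing the vertices `c + zᵢ` or the vertices `c - zᵢ` from
the points of `Λ` in the hexagon gives different convex subsets with the same X-rays
(`not_determined_of_hexagon`). To have the vertices in `Λ`, the `zᵢ` are multiplied by `5 τⁿ`: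
this makes the second component of their images under the star map vanish and the first one small,
and the centre `c` is chosen to be mapped into the interior of the pentagon `W⁽¹⁾`.
-/

namespace Penrose

/-! ### Differences of roots of unity modulo 11 -/

/-- Over `11`, the element `1 - η` has valuation at most `1 / 10`: this follows from
`Φₙ(1) = ∏ (1 - ηʲ)`, which is `p` for a power of a prime `p` and `1` otherwise. -/
lemma one_sub_pow_ten_dvd {R : Type*} [CommRing R] [IsDomain R] {η : R} {n : ℕ} (hn : n ≠ 0)
    (hη : IsPrimitiveRoot η n) (h1 : η ≠ 1) :
    ∃ m : ℕ, Nat.Coprime m 11 ∧ (1 - η) ^ 10 ∣ ((11 * m : ℕ) : R) := by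
  have hn2 : 2 ≤ n := by
    rcases Nat.lt_or_ge n 2 with h | h
    · have : n = 1 := by omega
      subst this
      exact absurd (IsPrimitiveRoot.one_right_iff.1 hη) h1
    · exact h
  have hprod : (Polynomial.cyclotomic n R).eval 1 = ∏ μ ∈ primitiveRoots n R, (1 - μ) := by
    rw [Polynomial.cyclotomic_eq_prod_X_sub_primitiveRoots hη, Polynomial.eval_prod]
    simp
  have hdvd : ∀ μ ∈ primitiveRoots n R, (1 - η) ∣ (1 - μ) := by
    intro μ hμ
    have hμ' := (mem_primitiveRoots (by omega)).1 hμ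
    have : NeZero n := ⟨hn⟩
    obtain ⟨i, -, rfl⟩ := hη.eq_pow_of_pow_eq_one hμ'.pow_eq_one
    simpa using sub_dvd_pow_sub_pow 1 η i
  have hpow : (1 - η) ^ n.totient ∣ (Polynomial.cyclotomic n R).eval 1 := by
    rw [hprod, ← hη.card_primitiveRoots, ← Finset.prod_const]
    exact Finset.prod_dvd_prod_of_dvd _ _ hdvd
  have hsingle : (1 - η) ∣ (Polynomial.cyclotomic n R).eval 1 :=
    (dvd_pow_self _ (Nat.totient_pos.2 (by omega)).ne').trans hpow
  by_cases hp2 : ∃ p k : ℕ, p.Prime ∧ n = p ^ (k + 1)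
  · obtain ⟨p, k, hp, rfl⟩ := hp2
    have : Fact p.Prime := ⟨hp⟩
    rw [Polynomial.eval_one_cyclotomic_prime_pow] at hpow hsingle
    by_cases h11 : p = 11
    · subst h11
      refine ⟨1, by norm_num, ?_⟩
      rw [Nat.totient_prime_pow hp (by omega)] at hpow
      refine dvd_trans (pow_dvd_pow _ ?_) (by simpa using hpow)
      have := Nat.one_le_pow k 11 (by norm_num)
      norm_num
      omega
    · refine ⟨p ^ 10, ?_, ?_⟩
      · exact Nat.Coprime.pow_left _ ((Nat.coprime_primes hp (by norm_num)).2 h11)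
      · push_cast
        exact (pow_dvd_pow_of_dvd hsingle 10).trans (dvd_mul_left _ _)
  · rw [Polynomial.eval_one_cyclotomic_not_prime_pow] at hsingle
    · refine ⟨1, by norm_num, ?_⟩
      have h : (1 - η) ^ 10 ∣ 1 := by simpa using pow_dvd_pow_of_dvd hsingle 10
      exact h.trans (one_dvd _)
    · intro p hp k hk
      cases k with
      | zero => simp at hk; omega
      | succ k => exact hp2 ⟨p, k, hp, hk.symm⟩

/-- The roots of `11 X² + X - 1`, one of which is the inverse of `3 τ - 1`, are not integral. -/
lemma not_isIntegral_of_eleven {y : ℂ} (hy : 11 * y ^ 2 + y - 1 = 0) : ¬ IsIntegral ℤ y := by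
  intro hint
  have h0 : Polynomial.aeval y
      (Polynomial.C 11 * Polynomial.X ^ 2 + Polynomial.X - 1 : Polynomial ℤ) = 0 := by
    simp only [map_sub, map_add, map_mul, Polynomial.aeval_C, map_pow, Polynomial.aeval_X, map_one]
    simpa using hy
  obtain ⟨g, hg⟩ := minpoly.isIntegrallyClosed_dvd hint h0
  have hm := minpoly.monic hint
  have hdeg : (Polynomial.C 11 * Polynomial.X ^ 2 + Polynomial.X - 1 : Polynomial ℤ).natDegree
      = 2 := by compute_degree!
  have hlead : (Polynomial.C 11 * Polynomial.X ^ 2 + Polynomial.X - 1 : Polynomial ℤ).coeff 2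
      = 11 := by
    simp [Polynomial.coeff_X, Polynomial.coeff_one]
  have hpos := minpoly.natDegree_pos hint
  have hg0 : g ≠ 0 := by
    rintro rfl
    rw [hg] at hdeg
    simp at hdeg
  have hsum : (minpoly ℤ y).natDegree + g.natDegree = 2 := by
    rw [← hm.natDegree_mul' hg0, ← hg, hdeg]
  have hev : (minpoly ℤ y).eval 0 * g.eval 0 = -1 := by
    rw [← Polynomial.eval_mul, ← hg]; simp
  by_cases hd : (minpoly ℤ y).natDegree = 1
  · obtain ⟨a, ha⟩ : ∃ a : ℤ, y = a := by
      have h2 := minpoly.aeval ℤ y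
      rw [hm.eq_X_add_C hd] at h2
      refine ⟨-(minpoly ℤ y).coeff 0, ?_⟩
      simp at h2
      push_cast
      linear_combination h2
    rw [ha] at hy
    have hy' : a * (11 * a + 1) = 1 := by
      have : ((a * (11 * a + 1) : ℤ) : ℂ) = (1 : ℤ) := by
        push_cast; linear_combination hy
      exact_mod_cast this
    rcases Int.isUnit_iff.1 (IsUnit.of_mul_eq_one _ hy') with rfl | rfl <;> omega
  · have hgd : g.natDegree = 0 := by omega
    rw [Polynomial.eq_C_of_natDegree_eq_zero hgd] at hg hev
    have hgc : g.coeff 0 = 11 := by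
      have h3 := congrArg (fun q => Polynomial.coeff q 2) hg
      simp only [Polynomial.coeff_mul_C] at h3
      have h4 : (minpoly ℤ y).coeff 2 = 1 := by
        have h5 : (minpoly ℤ y).natDegree = 2 := by omega
        have := hm.coeff_natDegree
        rwa [h5] at this
      rw [h4] at h3
      have h5 := hlead
      rw [hg] at h5
      simp only [Polynomial.coeff_mul_C, h4] at h5
      linarith
    rw [hgc] at hev
    simp at hev
    omega

/-- The cross ratio of `1 + τ, τ - 1, -τ, -2τ` is not the cross ratio of four roots of unity: it is
divisible by the prime `3 τ - 1` above `11`, whose valuation on a product of two differences of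
roots of unity is at most `1 / 5`. -/
lemma crossRatio_ne {ε₁ ε₂ ε₃ ε₄ : ℂ} {M : ℕ} (hM : M ≠ 0) (h₁ : ε₁ ^ M = 1) (h₂ : ε₂ ^ M = 1)
    (h₃ : ε₃ ^ M = 1) (h₄ : ε₄ ^ M = 1) (h13 : ε₁ ≠ ε₃) (h24 : ε₂ ≠ ε₄) :
    (1 + 2 * (Real.goldenRatio : ℂ)) * (3 * (Real.goldenRatio : ℂ) - 1) *
        ((ε₁ - ε₄) * (ε₂ - ε₃)) ≠
      (1 + 3 * (Real.goldenRatio : ℂ)) * (2 * (Real.goldenRatio : ℂ) - 1) *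
        ((ε₁ - ε₃) * (ε₂ - ε₄)) := by
  intro heq
  have hτ2 : (Real.goldenRatio : ℂ) ^ 2 = (Real.goldenRatio : ℂ) + 1 := by
    exact_mod_cast Real.goldenRatio_sq
  set τ : ℂ := (Real.goldenRatio : ℂ) with hτ
  have hroot : ∀ z : ℂ, z ^ M = 1 → IsIntegral ℤ z := fun z hz =>
    IsIntegral.of_pow (Nat.pos_of_ne_zero hM) (by rw [hz]; exact isIntegral_one)
  have hτi : IsIntegral ℤ τ := by
    refine ⟨Polynomial.X ^ 2 - Polynomial.X - 1, by monicity!, ?_⟩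
    simp [hτ2]
  let O := integralClosure ℤ ℂ
  let t : O := ⟨τ, hτi⟩
  have ht : t ^ 2 = t + 1 := Subtype.ext (by simpa [t] using hτ2)
  let e₁ : O := ⟨ε₁, hroot _ h₁⟩
  let e₂ : O := ⟨ε₂, hroot _ h₂⟩
  let e₃ : O := ⟨ε₃, hroot _ h₃⟩
  let e₄ : O := ⟨ε₄, hroot _ h₄⟩
  have E : (1 + 2 * t) * (3 * t - 1) * ((e₁ - e₄) * (e₂ - e₃)) =
      (1 + 3 * t) * (2 * t - 1) * ((e₁ - e₃) * (e₂ - e₄)) := Subtype.ext heq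
  have key : ∀ a b : O, a ^ M = 1 → b ^ M = 1 → a ≠ b →
      ∃ m : ℕ, Nat.Coprime m 11 ∧ (a - b) ^ 10 ∣ ((11 * m : ℕ) : O) := by
    intro a b ha hb hab
    have ha' : a * a ^ (M - 1) = 1 := by rw [← pow_succ', Nat.sub_add_cancel (by omega), ha]
    have hη : (a ^ (M - 1) * b) ^ M = 1 := by
      rw [mul_pow, hb, mul_one, ← pow_mul, mul_comm, pow_mul, ha, one_pow]
    obtain ⟨m, hm, hd⟩ := one_sub_pow_ten_dvd (η := a ^ (M - 1) * b)
      (n := orderOf (a ^ (M - 1) * b))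
      (orderOf_pos_iff.2 (isOfFinOrder_iff_pow_eq_one.2 ⟨M, by omega, hη⟩)).ne'
      (IsPrimitiveRoot.orderOf _) (by
        intro h
        apply hab
        calc a = a * (a ^ (M - 1) * b) := by rw [h, mul_one]
          _ = b := by rw [← mul_assoc, ha', one_mul])
    refine ⟨m, hm, ?_⟩
    have : a - b = a * (1 - a ^ (M - 1) * b) := by linear_combination b * ha'
    rw [this, mul_pow]
    exact (mul_dvd_mul_left _ hd).trans
      (((IsUnit.of_mul_eq_one _ ha').pow 10).mul_left_dvd.2 dvd_rfl)
  obtain ⟨m₁, hm₁, hd₁⟩ := key e₁ e₃ (Subtype.ext h₁) (Subtype.ext h₃)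
    (fun h => h13 (congrArg Subtype.val h))
  obtain ⟨m₂, hm₂, hd₂⟩ := key e₂ e₄ (Subtype.ext h₂) (Subtype.ext h₄)
    (fun h => h24 (congrArg Subtype.val h))
  -- the conjugate of `(1 + 3 τ) (2 τ - 1)` clears that factor up to the norm `25`
  have hB : (1 + 3 * t) * (2 * t - 1) * ((4 - 3 * t) * (1 - 2 * t)) = 25 := by
    linear_combination (65 + 36 * (t ^ 2 - t - 1)) * ht
  have hπ : (3 * t - 1) * (2 - 3 * t) = -11 := by linear_combination (-9) * ht
  have hd : (3 * t - 1) ∣ 25 * ((e₁ - e₃) * (e₂ - e₄)) := by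
    refine ⟨(1 + 2 * t) * ((e₁ - e₄) * (e₂ - e₃)) * ((4 - 3 * t) * (1 - 2 * t)), ?_⟩
    linear_combination (-((e₁ - e₃) * (e₂ - e₄))) * hB - ((4 - 3 * t) * (1 - 2 * t)) * E
  have hd10 : (3 * t - 1) ^ 10 ∣ (3 * t - 1) ^ 2 *
      ((2 - 3 * t) ^ 2 * ((25 ^ 10 * (m₁ * m₂) : ℕ) : O)) := by
    refine (pow_dvd_pow_of_dvd hd 10).trans ?_
    rw [mul_pow, mul_pow]
    have : (3 * t - 1) ^ 2 * ((2 - 3 * t) ^ 2 * ((25 ^ 10 * (m₁ * m₂) : ℕ) : O)) =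
        25 ^ 10 * (((11 * m₁ : ℕ) : O) * ((11 * m₂ : ℕ) : O)) := by
      rw [← mul_assoc, ← mul_pow, hπ]
      push_cast
      ring
    rw [this]
    exact mul_dvd_mul_left _ (mul_dvd_mul hd₁ hd₂)
  have hπ0 : (3 * t - 1) ≠ 0 := by
    intro h
    rw [h, zero_mul] at hπ
    norm_num at hπ
  have hd8 : (3 * t - 1) ∣ (2 - 3 * t) ^ 2 * ((25 ^ 10 * (m₁ * m₂) : ℕ) : O) := by
    rw [show (10 : ℕ) = 2 + 8 from rfl, pow_add, mul_dvd_mul_iff_left (pow_ne_zero 2 hπ0)] at hd10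
    exact (dvd_pow_self _ (by norm_num)).trans hd10
  have hcop : IsCoprime (3 * t - 1) ((2 - 3 * t) ^ 2) :=
    IsCoprime.pow_right ⟨1, 1, by ring⟩
  have hdm := hcop.dvd_of_dvd_mul_left hd8
  have hc : Nat.Coprime (25 ^ 10 * (m₁ * m₂)) 11 :=
    Nat.Coprime.mul_left (Nat.Coprime.pow_left _ (by norm_num)) (Nat.Coprime.mul_left hm₁ hm₂)
  have hc' : IsCoprime ((25 ^ 10 * (m₁ * m₂) : ℕ) : O) ((11 : ℕ) : O) := hc.cast
  have h11 : (3 * t - 1) ∣ ((11 : ℕ) : O) := ⟨-(2 - 3 * t), by push_cast; linear_combination hπ⟩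
  obtain ⟨y, hy⟩ := isUnit_iff_dvd_one.1 (hc'.isUnit_of_dvd' hdm h11)
  have hy' : (1 : ℂ) = (3 * τ - 1) * (y : ℂ) := congrArg Subtype.val hy
  refine not_isIntegral_of_eleven (y := (y : ℂ)) ?_ y.2
  have h11τ : (3 * τ - 1) ^ 2 - (3 * τ - 1) - 11 = 0 := by linear_combination 9 * hτ2
  linear_combination (-(y : ℂ) ^ 2) * h11τ + (-1 - (3 * τ - 1) * (y : ℂ) + (y : ℂ)) * hy'

/-! ### Blocks of equal sign -/

/-- A finite set of points with signs `sgn` is ordered by `key`, with ties only between points of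
equal sign. Then `f` numbers the `M` maximal blocks of equal sign by `0, …, M - 1`. The order enters
only through pairs of opposite sign. -/
structure IsBlockIndex {D : Type*} (sgn : D → Bool) (key : D → ℝ) (f : D → ℕ) (M : ℕ) : Prop where
  sgn_eq_iff : ∀ p q, sgn p = sgn q ↔ Even (f p + f q)
  lt_of_key_lt : ∀ p q, sgn p ≠ sgn q → key p < key q → f p < f q
  lt : ∀ p, f p < M
  surj : ∀ n < M, ∃ p, f p = n

/-- The length of the longest alternating chain below a point is a block index. -/
lemma exists_isBlockIndex {D : Type*} [Finite D] [Nonempty D] (sgn : D → Bool) (key : D → ℝ)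
    (hkey : ∀ p q, sgn p ≠ sgn q → key p ≠ key q) :
    ∃ (f : D → ℕ) (M : ℕ), IsBlockIndex sgn key f M := by
  have := Fintype.ofFinite D
  have hwf : WellFounded (fun p q : D => key p < key q) :=
    Finite.wellFounded_of_trans_of_irrefl (InvImage (· < ·) key)
  let f : D → ℕ := hwf.fix fun p IH => Finset.univ.sup fun q =>
    if h : key q < key p then (if sgn q ≠ sgn p then IH q h + 1 else 0) else 0
  have hf : ∀ p, f p = Finset.univ.sup fun q =>
      if key q < key p then (if sgn q ≠ sgn p then f q + 1 else 0) else 0 := by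
    intro p
    have := hwf.fix_eq (C := fun _ => ℕ) (fun p IH => Finset.univ.sup fun q =>
      if h : key q < key p then (if sgn q ≠ sgn p then IH q h + 1 else 0) else 0) p
    simpa [f] using this
  have hlt : ∀ p q, sgn p ≠ sgn q → key p < key q → f p < f q := by
    intro p q hs hk
    rw [hf q]
    refine lt_of_lt_of_le ?_ (Finset.le_sup (Finset.mem_univ p))
    simp [hk, hs]
  have hpred : ∀ p n, f p = n + 1 → ∃ q, sgn q ≠ sgn p ∧ f q = n := by
    intro p n hn
    obtain ⟨q, -, hq⟩ := Finset.exists_mem_eq_sup (Finset.univ : Finset D) Finset.univ_nonempty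
      (fun q => if key q < key p then (if sgn q ≠ sgn p then f q + 1 else 0) else 0)
    rw [← hf p, hn] at hq
    refine ⟨q, ?_⟩
    split_ifs at hq with h1 h2
    exact ⟨h2, by omega⟩
  have hdown : ∀ n m p, f p = n + m → ∃ q, f q = n := by
    intro n m
    induction m with
    | zero => exact fun p hp => ⟨p, hp⟩
    | succ m ih =>
      intro p hp
      obtain ⟨q, -, hq⟩ := hpred p (n + m) hp
      exact ih q hq
  obtain ⟨z, hz⟩ : ∃ z, f z = 0 := hdown 0 (f (Classical.arbitrary D)) _ (zero_add _).symm
  have hsgn : ∀ n p, f p = n → (sgn p = sgn z ↔ Even n) := by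
    intro n
    induction n with
    | zero =>
      intro p hp
      simp only [Even.zero, iff_true]
      by_contra hne
      rcases lt_or_gt_of_ne (hkey p z hne) with h | h
      · have := hlt p z hne h; omega
      · have := hlt z p (Ne.symm hne) h; omega
    | succ n ih =>
      intro p hp
      obtain ⟨q, hq, hqn⟩ := hpred p n hp
      have := ih q hqn
      rw [Nat.even_add_one, ← this]
      revert hq
      cases sgn q <;> cases sgn p <;> cases sgn z <;> simp
  refine ⟨f, Finset.univ.sup f + 1, ?_, hlt, fun p => ?_, fun n hn => ?_⟩
  · intro p q
    rw [Nat.even_add, ← hsgn _ p rfl, ← hsgn _ q rfl]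
    cases sgn q <;> cases sgn p <;> cases sgn z <;> simp
  · exact Nat.lt_succ_of_le (Finset.le_sup (Finset.mem_univ p))
  · obtain ⟨p, -, hp⟩ := Finset.exists_mem_eq_sup (Finset.univ : Finset D) Finset.univ_nonempty f
    exact hdown n (f p - n) p (by omega)

namespace IsBlockIndex

variable {D : Type*} {sgn : D → Bool} {key : D → ℝ} {f : D → ℕ} {M : ℕ}

lemma key_lt_of_lt_of_sgn_ne (h : IsBlockIndex sgn key f M)
    (hkey : ∀ p q, sgn p ≠ sgn q → key p ≠ key q) {p q : D} (hs : sgn p ≠ sgn q)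
    (hpq : f p < f q) : key p < key q := by
  rcases lt_or_gt_of_ne (hkey p q hs) with h1 | h1
  · exact h1
  · have := h.lt_of_key_lt q p (Ne.symm hs) h1
    omega

lemma key_lt_of_lt (h : IsBlockIndex sgn key f M)
    (hkey : ∀ p q, sgn p ≠ sgn q → key p ≠ key q) {p q : D} (hpq : f p < f q) :
    key p < key q := by
  by_cases hs : sgn p = sgn q
  · obtain ⟨r, hr⟩ := h.surj (f p + 1) (by have := h.lt q; omega)
    have hpr : sgn p ≠ sgn r := by
      rw [Ne, h.sgn_eq_iff, hr]; grind
    have hrq : f r < f q := by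
      have := (h.sgn_eq_iff p q).1 hs
      grind
    exact (h.key_lt_of_lt_of_sgn_ne hkey hpr (by omega)).trans
      (h.key_lt_of_lt_of_sgn_ne hkey (hs ▸ hpr.symm) hrq)
  · exact h.key_lt_of_lt_of_sgn_ne hkey hs hpq

/-- A block index is the least function that increases along alternating chains. -/
lemma le_of_strictMono (h : IsBlockIndex sgn key f M)
    (hkey : ∀ p q, sgn p ≠ sgn q → key p ≠ key q) {g : D → ℕ}
    (hg : ∀ p q, sgn p ≠ sgn q → key p < key q → g p < g q) (p : D) : f p ≤ g p := by
  suffices H : ∀ n p, f p = n → n ≤ g p from H _ p rfl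
  intro n
  induction n with
  | zero => exact fun p _ => Nat.zero_le _
  | succ n ih =>
    intro p hp
    obtain ⟨q, hq⟩ := h.surj n (by have := h.lt p; omega)
    have hs : sgn q ≠ sgn p := by
      rw [Ne, h.sgn_eq_iff, hq, hp]; grind
    have := hg q p hs (h.key_lt_of_lt_of_sgn_ne hkey hs (by omega))
    have := ih q hq
    omega

lemma reverse (h : IsBlockIndex sgn key f M) :
    IsBlockIndex sgn (fun p => -key p) (fun p => M - 1 - f p) M where
  sgn_eq_iff p q := by
    have h1 := h.lt p
    have h2 := h.lt q
    rw [h.sgn_eq_iff]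
    grind
  lt_of_key_lt p q hs hk := by
    have h1 := h.lt p
    have := h.lt_of_key_lt q p hs.symm (by linarith)
    omega
  lt p := by have := h.lt p; omega
  surj n hn := by
    obtain ⟨p, hp⟩ := h.surj (M - 1 - n) (by omega)
    exact ⟨p, by omega⟩

/-- A sign-changing order reversal reverses the numbering of the blocks. -/
lemma add_reflect (h : IsBlockIndex sgn key f M)
    (hkey : ∀ p q, sgn p ≠ sgn q → key p ≠ key q) {φ : D → D} (hs : ∀ p, sgn (φ p) ≠ sgn p)
    (hφ : ∀ p, key (φ p) = -key p) (p : D) : f p + f (φ p) + 1 = M := by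
  have hs' : ∀ p q, sgn p ≠ sgn q → sgn (φ q) ≠ sgn (φ p) := by
    intro p q hpq
    have h1 := hs p
    have h2 := hs q
    revert hpq h1 h2
    cases sgn p <;> cases sgn q <;> cases sgn (φ p) <;> cases sgn (φ q) <;> simp
  have h1 := h.le_of_strictMono hkey (g := fun p => M - 1 - f (φ p)) (by
    intro p q hpq hk
    have h3 := h.lt_of_key_lt (φ q) (φ p) (hs' p q hpq) (by rw [hφ, hφ]; linarith)
    have h4 := h.lt (φ p)
    omega) p
  have h2 := h.reverse.le_of_strictMono (fun p q hpq => by simpa using hkey p q hpq)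
    (g := fun p => f (φ p)) (by
      intro p q hpq hk
      exact h.lt_of_key_lt _ _ (hs' q p hpq.symm) (by rw [hφ, hφ]; exact hk)) p
  have h4 := h.lt (φ p)

  omega

lemma even_card (h : IsBlockIndex sgn key f M) {p q : D} (hs : sgn q ≠ sgn p)
    (hpq : f p + f q + 1 = M) : Even M := by
  have := (h.sgn_eq_iff q p).not.1 hs
  grind

end IsBlockIndex

/-! ### Points matched along the lines of a direction -/

/-- No point lies in the convex hull of at most three points of the opposite sign. The point is
given by the coordinates `x` and `y`, and the weights are not normalised. -/
def NoMixedHull {D : Type*} (sgn : D → Bool) (x y : D → ℝ) : Prop :=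
  ∀ p q r s, sgn q ≠ sgn p → sgn r ≠ sgn p → sgn s ≠ sgn p → ∀ a b c : ℝ,
    0 ≤ a → 0 ≤ b → 0 ≤ c → 0 < a + b + c →
    a * (x q - x p) + b * (x r - x p) + c * (x s - x p) = 0 →
    a * (y q - y p) + b * (y r - y p) + c * (y s - y p) = 0 → False

/-- The map `ψ` matches every point with a point of opposite sign on the same line
`y = const`. -/
structure IsMatching {D : Type*} (sgn : D → Bool) (y : D → ℝ) (ψ : D → D) : Prop where
  sgn_ne : ∀ p, sgn (ψ p) ≠ sgn p
  eq : ∀ p, y (ψ p) = y p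

/-- The position of a point in the clockwise order given by the lines `y = const`: points to
the left of their partner come first, by increasing `y`, then those to the right of their
partner, by decreasing `y`. The exponential makes both ranges bounded on one side, so that the
positions of two partners are negatives of each other. -/
noncomputable def sideKey {D : Type*} (x y : D → ℝ) (ψ : D → D) (p : D) : ℝ :=
  if x p < x (ψ p) then -Real.exp (-y p) else Real.exp (-y p)

section sideKey

variable {D : Type*} {sgn : D → Bool} {x y : D → ℝ} {ψ : D → D}

lemma NoMixedHull.swap (h : NoMixedHull sgn x y) : NoMixedHull sgn (fun p => -y p) x := by
  intro p q r s hq hr hs a b c ha hb hc habc h1 h2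
  exact h p q r s hq hr hs a b c ha hb hc habc h2 (by linear_combination -h1)

lemma NoMixedHull.lt_or_gt (h : NoMixedHull sgn x y) {p q : D} (hs : sgn q ≠ sgn p)
    (hy : y q = y p) : x p < x q ∨ x q < x p := by
  rcases lt_trichotomy (x p) (x q) with h1 | h1 | h1
  · exact Or.inl h1
  · exact (h p q q q hs hs hs 1 0 0 (by norm_num) le_rfl le_rfl (by norm_num)
      (by rw [h1]; ring) (by rw [hy]; ring)).elim
  · exact Or.inr h1

lemma NoMixedHull.not_between (h : NoMixedHull sgn x y) {p q r : D} (hq : sgn q ≠ sgn p)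
    (hr : sgn r ≠ sgn p) (hyq : y q = y p) (hyr : y r = y p) (h1 : x q < x p) (h2 : x p < x r) :
    False := by
  refine h p q r r hq hr hr (x r - x p) (x p - x q) 0 (by linarith) (by linarith) le_rfl
    (by linarith) (by ring) ?_
  rw [hyq, hyr]
  ring

/-- All points of the opposite sign on the line of `p` lie on the same side of `p`. -/
lemma NoMixedHull.left_iff (h : NoMixedHull sgn x y) (hψ : IsMatching sgn y ψ) {p q : D}
    (hs : sgn q ≠ sgn p) (hy : y q = y p) : x p < x (ψ p) ↔ x p < x q := by
  have h1 := h.lt_or_gt hs hy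
  have h2 := h.lt_or_gt (hψ.sgn_ne p) (hψ.eq p)
  constructor
  · intro h3
    refine h1.resolve_right fun h4 => h.not_between hs (hψ.sgn_ne p) hy (hψ.eq p) h4 h3
  · intro h3
    refine h2.resolve_right fun h4 => h.not_between (hψ.sgn_ne p) hs (hψ.eq p) hy h4 h3

lemma NoMixedHull.left_partner_iff (h : NoMixedHull sgn x y) (hψ : IsMatching sgn y ψ) (p : D) :
    x (ψ p) < x (ψ (ψ p)) ↔ ¬ x p < x (ψ p) := by
  rw [h.left_iff hψ (hψ.sgn_ne p).symm (hψ.eq p).symm]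
  have h2 := h.lt_or_gt (hψ.sgn_ne p) (hψ.eq p)
  constructor
  · exact fun h3 => h3.le.not_gt
  · exact fun h3 => h2.resolve_left h3

lemma sideKey_lt_iff (p q : D) : sideKey x y ψ p < sideKey x y ψ q ↔
    (x p < x (ψ p) ∧ ¬ x q < x (ψ q)) ∨ (x p < x (ψ p) ∧ x q < x (ψ q) ∧ y p < y q) ∨
      (¬ x p < x (ψ p) ∧ ¬ x q < x (ψ q) ∧ y q < y p) := by
  have hp := Real.exp_pos (-y p)
  have hq := Real.exp_pos (-y q)
  unfold sideKey
  by_cases h1 : x p < x (ψ p) <;> by_cases h2 : x q < x (ψ q) <;> simp [h1, h2] <;> linarith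

lemma sideKey_ne (h : NoMixedHull sgn x y) (hψ : IsMatching sgn y ψ) (p q : D)
    (hs : sgn p ≠ sgn q) : sideKey x y ψ p ≠ sideKey x y ψ q := by
  intro heq
  have h1 := (sideKey_lt_iff (x := x) (y := y) (ψ := ψ) p q).not.1 heq.not_lt
  have h2 := (sideKey_lt_iff (x := x) (y := y) (ψ := ψ) q p).not.1 heq.symm.not_lt
  have hy : y q = y p := by
    rcases lt_trichotomy (y p) (y q) with h3 | h3 | h3 <;> tauto
  have h3 := h.left_iff hψ hs.symm hy
  have h4 := h.left_iff hψ hs hy.symm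
  have h5 := h.lt_or_gt hs.symm hy
  rcases h5 with h5 | h5
  · have := h5.le.not_gt; tauto
  · have := h5.le.not_gt; tauto

lemma sideKey_partner (h : NoMixedHull sgn x y) (hψ : IsMatching sgn y ψ) (p : D) :
    sideKey x y ψ (ψ p) = -sideKey x y ψ p := by
  have := h.left_partner_iff hψ p
  unfold sideKey
  rw [hψ.eq]
  by_cases h1 : x p < x (ψ p) <;> simp [this, h1]

end sideKey

/-! ### Comparison of two directions -/

section TwoDirections

variable {D : Type*} {sgn : D → Bool} {x y : D → ℝ} {ψ φ : D → D}

/-- If `p` has partners `r` on its horizontal and `s` on its vertical line, then no point of the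
sign opposite to `p` lies in the quadrant opposite to the one spanned by `r` and `s`. -/
lemma NoMixedHull.not_opposite_quadrant (h : NoMixedHull sgn x y) {p q r s : D}
    (hq : sgn q ≠ sgn p) (hr : sgn r ≠ sgn p) (hs : sgn s ≠ sgn p) (hyr : y r = y p)
    (hxs : x s = x p) (hx : (x q - x p) * (x r - x p) ≤ 0)
    (hy : (y q - y p) * (y s - y p) ≤ 0) : False := by
  have hxr : x r - x p ≠ 0 := by
    rcases h.lt_or_gt hr hyr with h1 | h1 <;> intro h2 <;> linarith
  have hys : y s - y p ≠ 0 := by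
    rcases h.swap.lt_or_gt hs hxs with h1 | h1 <;> intro h2 <;> linarith
  refine h p q r s hq hr hs ((x r - x p) ^ 2 * (y s - y p) ^ 2)
    (-((x q - x p) * (x r - x p)) * (y s - y p) ^ 2)
    (-((y q - y p) * (y s - y p)) * (x r - x p) ^ 2) (by positivity)
    (mul_nonneg (by linarith) (by positivity)) (mul_nonneg (by linarith) (by positivity)) ?_ ?_ ?_
  · have h1 : 0 < (x r - x p) ^ 2 * (y s - y p) ^ 2 := by positivity
    have h2 : 0 ≤ -((x q - x p) * (x r - x p)) * (y s - y p) ^ 2 :=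
      mul_nonneg (by linarith) (by positivity)
    have h3 : 0 ≤ -((y q - y p) * (y s - y p)) * (x r - x p) ^ 2 :=
      mul_nonneg (by linarith) (by positivity)
    linarith
  · rw [hxs]; ring
  · rw [hyr]; ring

/-- The points that are to the left of their partner on `y = const` and below their partner on
`x = const`. The clockwise order starts with them if it is read along `y = const`, and it ends
with them if it is read along `x = const`. -/
def LeftDown (x y : D → ℝ) (ψ φ : D → D) (p : D) : Prop :=
  x p < x (ψ p) ∧ ¬ -y p < -y (φ p)

/-- The four quadrant conditions, for the four types of `p`. -/
lemma NoMixedHull.quadrants (h : NoMixedHull sgn x y) (hψ : IsMatching sgn y ψ)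
    (hφ : IsMatching sgn x φ) {p q : D} (hs : sgn q ≠ sgn p) :
    (x p < x (ψ p) → -y p < -y (φ p) → x q ≤ x p → y p ≤ y q → False) ∧
    (x p < x (ψ p) → ¬ -y p < -y (φ p) → x q ≤ x p → y q ≤ y p → False) ∧
    (¬ x p < x (ψ p) → -y p < -y (φ p) → x p ≤ x q → y p ≤ y q → False) ∧
    (¬ x p < x (ψ p) → ¬ -y p < -y (φ p) → x p ≤ x q → y q ≤ y p → False) := by
  have H := fun h1 h2 => h.not_opposite_quadrant hs (hψ.sgn_ne p) (hφ.sgn_ne p) (hψ.eq p)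
    (hφ.eq p) h1 h2
  refine ⟨fun h1 h2 h3 h4 => H ?_ ?_, fun h1 h2 h3 h4 => H ?_ ?_, fun h1 h2 h3 h4 => H ?_ ?_,
    fun h1 h2 h3 h4 => H ?_ ?_⟩
  all_goals first
    | exact mul_nonpos_of_nonneg_of_nonpos (by linarith) (by linarith)
    | exact mul_nonpos_of_nonpos_of_nonneg (by linarith) (by linarith)

lemma NoMixedHull.leftDown_lt (h : NoMixedHull sgn x y) (hψ : IsMatching sgn y ψ)
    (hφ : IsMatching sgn x φ) {p q : D} (hs : sgn q ≠ sgn p) (hp : LeftDown x y ψ φ p)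
    (hq : ¬ LeftDown x y ψ φ q) :
    sideKey x y ψ p < sideKey x y ψ q ∧
      sideKey (fun p => -y p) x φ q < sideKey (fun p => -y p) x φ p := by
  obtain ⟨-, a2, -, -⟩ := h.quadrants hψ hφ hs
  obtain ⟨b1, b2, b3, b4⟩ := h.quadrants hψ hφ hs.symm
  obtain ⟨hp1, hp2⟩ := hp
  unfold LeftDown at hq
  specialize a2 hp1 hp2
  rw [sideKey_lt_iff, sideKey_lt_iff]
  by_cases hq1 : x q < x (ψ q) <;> by_cases hq2 : -y q < -y (φ q) <;>
    simp only [hp1, hp2, hq1, hq2, true_and, false_and, and_true, and_false, not_true_eq_false,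
      not_false_eq_true, or_false, false_or, forall_true_left, and_self] at * <;>
    grind

lemma NoMixedHull.key_lt_key (h : NoMixedHull sgn x y) (hψ : IsMatching sgn y ψ)
    (hφ : IsMatching sgn x φ) {p q : D} (hs : sgn q ≠ sgn p)
    (hpq : LeftDown x y ψ φ p ↔ LeftDown x y ψ φ q) (hk : sideKey x y ψ p < sideKey x y ψ q) :
    sideKey (fun p => -y p) x φ p < sideKey (fun p => -y p) x φ q := by
  obtain ⟨a1, a2, a3, a4⟩ := h.quadrants hψ hφ hs
  obtain ⟨b1, b2, b3, b4⟩ := h.quadrants hψ hφ hs.symm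
  unfold LeftDown at hpq
  rw [sideKey_lt_iff] at hk ⊢
  by_cases hp1 : x p < x (ψ p) <;> by_cases hp2 : -y p < -y (φ p) <;>
  by_cases hq1 : x q < x (ψ q) <;> by_cases hq2 : -y q < -y (φ q) <;>
    simp only [hp1, hp2, hq1, hq2, true_and, false_and, and_true, and_false, not_true_eq_false,
      not_false_eq_true, or_false, false_or, forall_true_left, and_self] at * <;>
    grind

/-- Matching along a second direction also reverses the cyclic order of the blocks: both orders
run through the same cycle, from different starting points. -/
lemma IsBlockIndex.exists_add_matching [Finite D] (h : NoMixedHull sgn x y)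
    (hψ : IsMatching sgn y ψ) (hφ : IsMatching sgn x φ) {f : D → ℕ} {M : ℕ}
    (hf : IsBlockIndex sgn (sideKey x y ψ) f M) :
    ∃ c : ZMod M, ∀ p, (f p : ZMod M) + (f (φ p) : ZMod M) = c := by
  rcases isEmpty_or_nonempty D with hD | hD
  · exact ⟨0, fun p => hD.elim p⟩
  have := Fintype.ofFinite D
  set kh := sideKey x y ψ with hkh
  set kv := sideKey (fun p => -y p) x φ with hkv
  set LD := LeftDown x y ψ φ with hLD
  have hne := sideKey_ne h hψ
  have hne' := sideKey_ne h.swap hφ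
  rw [← hkh] at hne
  rw [← hkv] at hne'
  have hlow : ∀ p q, sgn q ≠ sgn p → LD p → ¬ LD q → kh p < kh q ∧ kv q < kv p :=
    fun p q => h.leftDown_lt hψ hφ
  have hsame : ∀ p q, sgn q ≠ sgn p → (LD p ↔ LD q) → kh p < kh q → kv p < kv q :=
    fun p q => h.key_lt_key hψ hφ
  have hsame' : ∀ p q, sgn q ≠ sgn p → (LD p ↔ LD q) → kv p < kv q → kh p < kh q := by
    intro p q hs hpq hk
    rcases lt_or_gt_of_ne (hne p q hs.symm) with h1 | h1
    · exact h1
    · exact absurd (hsame q p hs.symm hpq.symm h1) hk.not_gt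
  have hMeven : Even M := by
    have p := Classical.arbitrary D
    exact hf.even_card (hψ.sgn_ne p) (hf.add_reflect hne hψ.sgn_ne (sideKey_partner h hψ) p)
  -- the blocks of the points in `LD` are exactly the first `k` blocks
  obtain ⟨k, hk1, hk2, hkM⟩ : ∃ k, (∀ p, LD p → f p < k) ∧ (∀ p, ¬ LD p → k ≤ f p) ∧ k ≤ M := by
    by_cases hex : ∃ p, LD p
    · classical
      obtain ⟨z, hz, hzmax⟩ := Finset.exists_max_image (Finset.univ.filter LD) f
        (by obtain ⟨p, hp⟩ := hex; exact ⟨p, by simpa using hp⟩)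
      simp only [Finset.mem_filter, Finset.mem_univ, true_and] at hz hzmax
      refine ⟨f z + 1, fun p hp => Nat.lt_succ_of_le (hzmax p hp), fun q hq => ?_, hf.lt z⟩
      by_contra hlt
      have hle : f q ≤ f z := by omega
      have hs : sgn q = sgn z := by
        by_contra hs
        have := hf.lt_of_key_lt z q (Ne.symm hs) (hlow z q hs hz hq).1
        omega
      rcases hle.lt_or_eq with hlt | heq
      · obtain ⟨r, hr⟩ := hf.surj (f q + 1) (by have := hf.lt z; omega)
        have hrq : sgn r ≠ sgn q := by rw [Ne, hf.sgn_eq_iff, hr]; grind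
        have hrz : f r < f z := by
          have := (hf.sgn_eq_iff q z).1 hs
          grind
        by_cases hrLD : LD r
        · have := hf.lt_of_key_lt r q hrq (hlow r q hrq.symm hrLD hq).1
          omega
        · have := hf.lt_of_key_lt z r (hs ▸ hrq.symm) (hlow z r (hs ▸ hrq) hz hrLD).1
          omega
      · -- a block that meets both `LD` and its complement would contain the first and the last
        -- point along the lines `x = const`, which have opposite signs
        obtain ⟨w, -, hw⟩ := Finset.exists_min_image (Finset.univ : Finset D) kv
          Finset.univ_nonempty
        have hwlast : ∀ p, kv p ≤ kv (φ w) := by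
          intro p
          have h1 := hw (φ p) (Finset.mem_univ _)
          have h2 : ∀ p, kv (φ p) = -kv p := sideKey_partner h.swap hφ
          rw [h2] at h1 ⊢
          linarith
        by_cases hwz : sgn w = sgn z
        · have hs' : sgn (φ w) ≠ sgn z := hwz ▸ hφ.sgn_ne w
          have hlt' : kv z < kv (φ w) := lt_of_le_of_ne (hwlast z) (hne' _ _ hs'.symm)
          have hw' : LD (φ w) := by
            by_contra hw'
            exact (hlow z (φ w) hs' hz hw').2.not_gt hlt'
          have h1 := hf.lt_of_key_lt z (φ w) hs'.symm
            (hsame' z (φ w) hs' (iff_of_true hz hw') hlt')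
          have := hzmax _ hw'
          omega
        · have hwq : sgn q ≠ sgn w := hs ▸ Ne.symm hwz
          have hlt' : kv w < kv q := lt_of_le_of_ne (hw q (Finset.mem_univ _)) (hne' _ _ hwq.symm)
          have hw' : ¬ LD w := by
            intro hw'
            exact (hlow w q hwq hw' hq).2.not_gt hlt'
          have h1 := hf.lt_of_key_lt w q hwq.symm
            (hsame' w q hwq (iff_of_false hw' hq) hlt')
          have h2 := hf.lt_of_key_lt z w (Ne.symm hwz) (hlow z w hwz hz hw').1
          omega
    · exact ⟨0, fun p hp => absurd ⟨p, hp⟩ hex, fun _ _ => Nat.zero_le _, Nat.zero_le _⟩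
  classical
  let g : D → ℕ := fun p => if LD p then f p + M - k else f p - k
  have hg : ∀ p, (LD p ∧ f p < k ∧ g p + k = f p + M) ∨ (¬ LD p ∧ k ≤ f p ∧ g p + k = f p) := by
    intro p
    by_cases hp : LD p
    · have := hk1 p hp
      left
      simp only [g, hp, if_true, true_and, this]
      omega
    · have := hk2 p hp
      right
      simp only [g, hp, if_false, not_false_eq_true, true_and, this]
      omega
  have hgv : IsBlockIndex sgn kv g M := by
    refine ⟨fun p q => ?_, fun p q hs hpq => ?_, fun p => ?_, fun n hn => ?_⟩
    · rw [hf.sgn_eq_iff]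
      have := hg p
      have := hg q
      grind
    · have h1 := hf.lt p
      have h2 := hf.lt q
      rcases hg p with ⟨p1, p2, p3⟩ | ⟨p1, p2, p3⟩ <;> rcases hg q with ⟨q1, q2, q3⟩ | ⟨q1, q2, q3⟩
      · have := hf.lt_of_key_lt p q hs (hsame' p q hs.symm (iff_of_true p1 q1) hpq)
        omega
      · exact absurd (hlow p q hs.symm p1 q1).2 hpq.not_gt
      · omega
      · have := hf.lt_of_key_lt p q hs (hsame' p q hs.symm (iff_of_false p1 q1) hpq)
        omega
    · have h1 := hf.lt p
      have := hg p
      omega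
    · by_cases hnk : n + k < M
      · obtain ⟨p, hp⟩ := hf.surj (n + k) hnk
        exact ⟨p, by have := hg p; omega⟩
      · obtain ⟨p, hp⟩ := hf.surj (n + k - M) (by omega)
        exact ⟨p, by have := hg p; omega⟩
  have hgk : ∀ p, (f p : ZMod M) = g p + k := by
    intro p
    rcases hg p with ⟨-, -, h1⟩ | ⟨-, -, h1⟩
    · have h2 := congrArg (Nat.cast : ℕ → ZMod M) h1
      push_cast at h2
      rw [ZMod.natCast_self, add_zero] at h2
      exact h2.symm
    · exact_mod_cast (congrArg (Nat.cast : ℕ → ZMod M) h1).symm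
  refine ⟨2 * k - 1, fun p => ?_⟩
  have h1 := congrArg (Nat.cast : ℕ → ZMod M)
    (hgv.add_reflect hne' hφ.sgn_ne (sideKey_partner h.swap hφ) p)
  push_cast at h1
  rw [ZMod.natCast_self] at h1
  rw [hgk, hgk]
  linear_combination h1

end TwoDirections

/-! ### First Fourier moments of the blocks -/

section Fourier

variable {D : Type*} {sgn : D → Bool} {x y : D → ℝ} {ψ φ : Equiv.Perm D} {f : D → ℕ} {M : ℕ}

lemma IsBlockIndex.left_iff (h : NoMixedHull sgn x y) (hψ : IsMatching sgn y ψ)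
    (hf : IsBlockIndex sgn (sideKey x y ψ) f M) (p : D) :
    x p < x (ψ p) ↔ 2 * f p + 1 < M := by
  have hM := hf.add_reflect (sideKey_ne h hψ) hψ.sgn_ne (sideKey_partner h hψ) p
  have h1 := h.left_partner_iff hψ p
  constructor
  · intro h2
    have := hf.lt_of_key_lt p (ψ p) (hψ.sgn_ne p).symm
      ((sideKey_lt_iff _ _).2 (Or.inl ⟨h2, fun h3 => h1.1 h3 h2⟩))
    omega
  · intro h2
    by_contra h3
    have := hf.lt_of_key_lt (ψ p) p (hψ.sgn_ne p)
      ((sideKey_lt_iff _ _).2 (Or.inl ⟨h1.2 h3, h3⟩))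
    omega

/-- Two different directions induce different reflections of the blocks: otherwise both matchings
exchange the same two halves, but one of them preserves the coordinate `x` while the other one
increases it. -/
lemma IsBlockIndex.not_forall_add [Fintype D] [Nonempty D] (h : NoMixedHull sgn x y)
    (hψ : IsMatching sgn y ψ) (hφ : IsMatching sgn x φ)
    (hf : IsBlockIndex sgn (sideKey x y ψ) f M) : ¬ ∀ p, f p + f (φ p) + 1 = M := by
  intro hall
  have hM := hf.add_reflect (sideKey_ne h hψ) hψ.sgn_ne (sideKey_partner h hψ)
  have heven := hf.even_card (hψ.sgn_ne (Classical.arbitrary D)) (hM _)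
  have hl := hf.left_iff h hψ
  have hlφ : ∀ p, x p < x (ψ p) ↔ ¬ x (φ p) < x (ψ (φ p)) := by
    intro p
    rw [hl, hl]
    have := hall p
    grind
  have hlψ : ∀ p, x p < x (ψ p) ↔ ¬ x (ψ p) < x (ψ (ψ p)) := by
    intro p
    rw [h.left_partner_iff hψ, not_not]
  classical
  have h1 : ∑ p with x p < x (ψ p), x p = ∑ p with ¬ x p < x (ψ p), x p :=
    Finset.sum_equiv φ (by simpa using hlφ) (fun p _ => (hφ.eq p).symm)
  have h2 : ∑ p with x p < x (ψ p), x (ψ p) = ∑ p with ¬ x p < x (ψ p), x p :=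
    Finset.sum_equiv ψ (by simpa using hlψ) (fun p _ => rfl)
  have h3 : ∑ p with x p < x (ψ p), x p < ∑ p with x p < x (ψ p), x (ψ p) := by
    refine Finset.sum_lt_sum_of_nonempty ?_ fun p hp => by simpa using hp
    by_cases hz : x (Classical.arbitrary D) < x (ψ (Classical.arbitrary D))
    · exact ⟨_, by simpa using hz⟩
    · exact ⟨ψ (Classical.arbitrary D), by simpa using (h.left_partner_iff hψ _).2 hz⟩
  linarith

lemma pow_eq_of_cast_eq {ω : ℂ} (hω : ω ^ M = 1) {a b : ℕ} (h : (a : ZMod M) = b) :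
    ω ^ a = ω ^ b := by
  rw [pow_eq_pow_mod a hω, pow_eq_pow_mod b hω, (ZMod.natCast_eq_natCast_iff' a b M).1 h]

/-- A matching along the lines `x = const` relates the first Fourier moment of `x` to its
conjugate. -/
lemma sum_mul_pow_eq [Fintype D] {ω : ℂ} (hM : M ≠ 0) (hω : ω ^ M = 1) (hφ : ∀ p, x (φ p) = x p) {c : ZMod M}
    (hc : ∀ p, (f p : ZMod M) + (f (φ p) : ZMod M) = c) :
    ∑ p, (x p : ℂ) * ω ^ f p = ω ^ c.val * ∑ p, (x p : ℂ) * (ω ^ f p)⁻¹ := by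
  have : NeZero M := ⟨hM⟩
  have hω0 : ω ≠ 0 := by
    rintro rfl
    rw [zero_pow hM] at hω
    exact zero_ne_one hω
  rw [← Equiv.sum_comp φ, Finset.mul_sum]
  refine Finset.sum_congr rfl fun p _ => ?_
  have h1 : ω ^ (f p + f (φ p)) = ω ^ c.val := by
    apply pow_eq_of_cast_eq hω
    rw [ZMod.natCast_zmod_val]
    push_cast
    exact hc p
  rw [← h1, hφ, pow_add]
  field_simp

/-- With a suitable origin, the first Fourier moment of the coordinate `y` does not vanish. The
blocks are passed upwards on the left and downwards on the right, so that `y` can be normalised to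
have the sign opposite to that of the cosine at each block. -/
lemma IsBlockIndex.exists_sum_ne_zero [Fintype D] [Nonempty D]
    (h : NoMixedHull sgn x y) (hψ : IsMatching sgn y ψ)
    (hf : IsBlockIndex sgn (sideKey x y ψ) f M) (hM2 : 2 < M) :
    ∃ θ : ℝ, ∑ p, ((y p - θ : ℝ) : ℂ) * Complex.exp (2 * Real.pi * Complex.I / M) ^ f p ≠ 0 := by
  have hM := hf.add_reflect (sideKey_ne h hψ) hψ.sgn_ne (sideKey_partner h hψ)
  have hl := hf.left_iff h hψ
  have hMr : (2 : ℝ) < M := by exact_mod_cast hM2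
  have hM0 : (0 : ℝ) < M := by linarith
  have hπ := Real.pi_pos
  obtain ⟨m, hm⟩ := hf.even_card (hψ.sgn_ne (Classical.arbitrary D)) (hM _)
  set α : D → ℝ := fun p => (2 * f p + 1) * (Real.pi / M) with hα
  have hcos : ∀ p, Real.cos (α (ψ p)) = Real.cos (α p) := by
    intro p
    have h1 : α (ψ p) = 2 * Real.pi - α p := by
      have h2 : (f p : ℝ) + f (ψ p) + 1 = M := by exact_mod_cast hM p
      simp only [hα]
      field_simp
      linear_combination 2 * h2
    rw [h1, Real.cos_two_pi_sub]
  have hleft : ∀ p, ∃ p', x p' < x (ψ p') ∧ y p' = y p ∧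
      Real.cos (α p') = Real.cos (α p) := by
    intro p
    by_cases hp : x p < x (ψ p)
    · exact ⟨p, hp, rfl, rfl⟩
    · exact ⟨ψ p, (h.left_partner_iff hψ p).2 hp, hψ.eq p, hcos p⟩
  have hα0 : ∀ p, 0 ≤ α p := fun p => by positivity
  have hαπ : ∀ p, x p < x (ψ p) → α p ≤ Real.pi := by
    intro p hp
    have h1 : (2 * f p + 1 : ℝ) ≤ M := by exact_mod_cast ((hl p).1 hp).le
    have h2 := mul_le_mul_of_nonneg_right h1 (div_nonneg hπ.le hM0.le)
    rwa [mul_div_cancel₀ _ hM0.ne'] at h2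
  have hmono : ∀ p q, Real.cos (α q) < Real.cos (α p) → y p < y q := by
    intro p q hpq
    obtain ⟨p', hp1, hp2, hp3⟩ := hleft p
    obtain ⟨q', hq1, hq2, hq3⟩ := hleft q
    rw [← hp3, ← hq3] at hpq
    rw [← hp2, ← hq2]
    have h1 : α p' < α q' := by
      by_contra h2
      exact (Real.cos_le_cos_of_nonneg_of_le_pi (hα0 q') (hαπ p' hp1) (not_lt.1 h2)).not_gt hpq
    have h2 : f p' < f q' := by
      have h3 := lt_of_mul_lt_mul_right h1 (div_nonneg hπ.le hM0.le)
      have h4 : (f p' : ℝ) < f q' := by linarith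
      exact_mod_cast h4
    have h3 := (sideKey_lt_iff _ _).1 (hf.key_lt_of_lt (sideKey_ne h hψ) h2)
    tauto
  obtain ⟨z, hz⟩ : ∃ z, 0 < Real.cos (α z) := by
    obtain ⟨z, hz⟩ := hf.surj 0 (by omega)
    refine ⟨z, Real.cos_pos_of_mem_Ioo ⟨by linarith [hα0 z], ?_⟩⟩
    simp only [hα, hz, Nat.cast_zero, mul_zero, zero_add, one_mul]
    exact div_lt_div_of_pos_left hπ (by norm_num) hMr
  obtain ⟨w, hw⟩ : ∃ w, Real.cos (α w) < 0 := by
    obtain ⟨w, hw⟩ := hf.surj (m - 1) (by omega)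
    have h1 : α w = Real.pi - Real.pi / M := by
      have h2 : (2 * f w + 1 + 1 : ℝ) = M := by
        rw [hw]; norm_cast; omega
      simp only [hα]
      field_simp
      linear_combination h2
    have h2 : Real.pi / M < Real.pi / 2 := div_lt_div_of_pos_left hπ (by norm_num) hMr
    have h3 : 0 < Real.pi / M := by positivity
    refine ⟨w, Real.cos_neg_of_pi_div_two_lt_of_lt ?_ ?_⟩ <;> rw [h1] <;> linarith
  classical
  -- the origin is the highest point with positive cosine
  obtain ⟨v, hv, hvmax⟩ := Finset.exists_max_image (Finset.univ.filter fun p => 0 < Real.cos (α p))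
    y ⟨z, by simpa using hz⟩
  simp only [Finset.mem_filter, Finset.mem_univ, true_and] at hv hvmax
  refine ⟨y v, fun hzero => ?_⟩
  have hneg : ∑ p, (y p - y v) * Real.cos (α p) < 0 := by
    refine Finset.sum_neg' (fun p _ => ?_) ⟨w, Finset.mem_univ _, ?_⟩
    · rcases lt_trichotomy 0 (Real.cos (α p)) with h1 | h1 | h1
      · exact mul_nonpos_of_nonpos_of_nonneg (by linarith [hvmax p h1]) h1.le
      · rw [← h1, mul_zero]
      · exact mul_nonpos_of_nonneg_of_nonpos (by linarith [hmono v p (h1.trans hv)]) h1.le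
    · exact mul_neg_of_pos_of_neg (by linarith [hmono v w (hw.trans hv)]) hw
  have hre : (Complex.exp (Real.pi / M * Complex.I) *
      ∑ p, ((y p - y v : ℝ) : ℂ) * Complex.exp (2 * Real.pi * Complex.I / M) ^ f p).re =
        ∑ p, (y p - y v) * Real.cos (α p) := by
    rw [Finset.mul_sum, Complex.re_sum]
    refine Finset.sum_congr rfl fun p _ => ?_
    rw [mul_left_comm, Complex.re_ofReal_mul, ← Complex.exp_nat_mul, ← Complex.exp_add,
      ← Complex.exp_ofReal_mul_I_re]
    congr 3
    simp only [hα]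
    push_cast
    ring
  rw [hzero, mul_zero, Complex.zero_re] at hre
  linarith

end Fourier

/-- The `j`-th of the four directions is parallel to `slope j + ζ₅`. -/
noncomputable def slope : Fin 4 → ℝ :=
  ![1 + Real.goldenRatio, Real.goldenRatio - 1, -Real.goldenRatio, -2 * Real.goldenRatio]

lemma slope_lt {j : Fin 4} (hj : j ≠ 0) : slope j < slope 0 := by
  have := Real.one_lt_goldenRatio
  fin_cases j
  · exact absurd rfl hj
  all_goals simp [slope]; linarith

lemma slope_injective : Function.Injective slope := by
  have h1 := Real.one_lt_goldenRatio
  have h2 := Real.goldenRatio_lt_two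
  intro i j hij
  fin_cases i <;> fin_cases j <;> simp [slope] at hij ⊢ <;> linarith

/-- A finite set of signed points cannot be matched along the lines of all four directions. -/
theorem no_matching_four {D : Type*} [Fintype D] [Nonempty D] {sgn : D → Bool} {s t : D → ℝ}
    (h : NoMixedHull sgn s t) (ψ : Fin 4 → Equiv.Perm D)
    (hψ : ∀ j, IsMatching sgn (fun p => s p - slope j * t p) (ψ j)) : False := by
  set L : Fin 4 → D → ℝ := fun j p => s p - slope j * t p with hL
  have hx : ∀ j, j ≠ 0 → NoMixedHull sgn (L j) (L 0) := by
    intro j hj p q r u hq hr hu a b c ha hb hc habc h1 h2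
    have hlt := slope_lt hj
    have ht : a * (t q - t p) + b * (t r - t p) + c * (t u - t p) = 0 := by
      have h3 : (slope 0 - slope j) * (a * (t q - t p) + b * (t r - t p) + c * (t u - t p)) = 0 := by
        simp only [hL] at h1 h2
        linear_combination h1 - h2
      exact (mul_eq_zero.1 h3).resolve_left (by linarith)
    refine h p q r u hq hr hu a b c ha hb hc habc ?_ ht
    simp only [hL] at h1
    linear_combination h1 + slope j * ht
  -- the side of a point does not depend on the second direction
  have hkey : ∀ j, j ≠ 0 → sideKey (L j) (L 0) (ψ 0) = sideKey (L 1) (L 0) (ψ 0) := by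
    have hside : ∀ j, j ≠ 0 → ∀ p, L j p < L j (ψ 0 p) ↔ t p < t (ψ 0 p) := by
      intro j hj p
      have h1 := (hψ 0).eq p
      have h2 : L j (ψ 0 p) - L j p = (slope 0 - slope j) * (t (ψ 0 p) - t p) := by
        simp only [hL] at h1 ⊢
        linear_combination h1
      have h3 : 0 < slope 0 - slope j := by linarith [slope_lt hj]
      rw [← sub_pos, h2, mul_pos_iff_of_pos_left h3, sub_pos]
    intro j hj
    funext p
    simp only [sideKey, hside j hj, hside 1 (by decide)]
  obtain ⟨f, M, hf⟩ := exists_isBlockIndex sgn (sideKey (L 1) (L 0) (ψ 0))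
    (sideKey_ne (hx 1 (by decide)) (hψ 0))
  have hfj : ∀ j, j ≠ 0 → IsBlockIndex sgn (sideKey (L j) (L 0) (ψ 0)) f M := by
    intro j hj
    rw [hkey j hj]
    exact hf
  have hM := hf.add_reflect (sideKey_ne (hx 1 (by decide)) (hψ 0)) (hψ 0).sgn_ne
    (sideKey_partner (hx 1 (by decide)) (hψ 0))
  have hM0 : M ≠ 0 := by
    have := hM (Classical.arbitrary D)
    omega
  have : NeZero M := ⟨hM0⟩
  have hneg : ∀ p, (f p : ZMod M) + (f (ψ 0 p) : ZMod M) = -1 := by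
    intro p
    have h1 := congrArg (Nat.cast : ℕ → ZMod M) (hM p)
    push_cast at h1
    rw [ZMod.natCast_self] at h1
    linear_combination h1
  have hcex : ∀ j, ∃ c : ZMod M, (∀ p, (f p : ZMod M) + (f (ψ j p) : ZMod M) = c) ∧
      (j ≠ 0 → c ≠ -1) ∧ (j = 0 → c = -1) := by
    intro j
    by_cases hj : j = 0
    · subst hj
      exact ⟨-1, hneg, fun h => absurd rfl h, fun _ => rfl⟩
    · obtain ⟨c, hc⟩ := IsBlockIndex.exists_add_matching (hx j hj) (hψ 0) (hψ j) (hfj j hj)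
      refine ⟨c, hc, fun _ hc1 => ?_, fun h => absurd h hj⟩
      refine IsBlockIndex.not_forall_add (hx j hj) (hψ 0) (hψ j) (hfj j hj) fun p => ?_
      have h1 : ((f p + f (ψ j p) + 1 : ℕ) : ZMod M) = 0 := by
        push_cast
        rw [hc, hc1]
        ring
      obtain ⟨d, hd⟩ := (ZMod.natCast_eq_zero_iff _ _).1 h1
      have h2 := hf.lt p
      have h3 := hf.lt (ψ j p)
      have h4 : d = 1 := by
        rcases d with _ | _ | d
        · omega
        · rfl
        · nlinarith
      rw [hd, h4, mul_one]
  choose c hc hc1 hc0 using hcex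
  have hM2 : 2 < M := by
    by_contra hle
    refine IsBlockIndex.not_forall_add (hx 1 (by decide)) (hψ 0) (hψ 1) hf fun p => ?_
    have h1 := hM p
    have h2 := hf.lt p
    have h3 := hf.lt (ψ 1 p)
    have h4 := (hf.sgn_eq_iff _ _).not.1 ((hψ 1).sgn_ne p)
    have h5 := (hf.sgn_eq_iff _ _).not.1 ((hψ 0).sgn_ne p)
    grind
  obtain ⟨θ, hθ⟩ := hf.exists_sum_ne_zero (hx 1 (by decide)) (hψ 0) hM2
  set ω := Complex.exp (2 * Real.pi * Complex.I / M) with hω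
  have hprim : IsPrimitiveRoot ω M := Complex.isPrimitiveRoot_exp M hM0
  set ε : Fin 4 → ℂ := fun j => ω ^ (c j).val with hε
  have hε0 : ∀ j, j ≠ 0 → ε 0 ≠ ε j := by
    intro j hj heq
    have h1 := hprim.pow_inj (ZMod.val_lt _) (ZMod.val_lt _) heq
    exact hc1 j hj (by rw [← ZMod.val_injective M h1]; exact hc0 0 rfl)
  set A := ∑ p, ((s p - θ : ℝ) : ℂ) * ω ^ f p with hA
  set B := ∑ p, (t p : ℂ) * ω ^ f p with hB
  set A' := ∑ p, ((s p - θ : ℝ) : ℂ) * (ω ^ f p)⁻¹ with hA'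
  set B' := ∑ p, (t p : ℂ) * (ω ^ f p)⁻¹ with hB'
  have hrel : ∀ j, A - slope j * B = ε j * (A' - slope j * B') := by
    intro j
    have h1 := sum_mul_pow_eq (x := fun p => L j p - θ) (ω := ω) hM0 hprim.pow_eq_one
      (fun p => congrArg (· - θ) ((hψ j).eq p)) (hc j)
    have h2 : ∀ g : D → ℂ, ∑ p, ((L j p - θ : ℝ) : ℂ) * g p =
        ∑ p, ((s p - θ : ℝ) : ℂ) * g p - slope j * ∑ p, (t p : ℂ) * g p := by
      intro g
      rw [Finset.mul_sum, ← Finset.sum_sub_distrib]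
      refine Finset.sum_congr rfl fun p _ => ?_
      simp only [hL]
      push_cast
      ring
    rw [h2, h2] at h1
    exact h1
  have hne0 : A - slope 0 * B ≠ 0 := by
    intro h0
    apply hθ
    rw [← h0, hA, hB, Finset.mul_sum, ← Finset.sum_sub_distrib]
    refine Finset.sum_congr rfl fun p _ => ?_
    simp only [hL]
    push_cast
    ring
  set Q : Fin 4 → ℂ := fun j => A' - slope j * B' with hQ
  set Δ := A * B' - A' * B with hΔ
  have hQΔ : ∀ i j, (ε i - ε j) * (Q i * Q j) = (slope i - slope j) * Δ := by
    intro i j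
    simp only [hQ, hΔ]
    linear_combination (-(A' - slope j * B')) * hrel i + (A' - slope i * B') * hrel j
  have hQ0 : Q 0 ≠ 0 := by
    intro h0
    apply hne0
    rw [hrel 0]
    exact mul_eq_zero_of_right _ h0
  have hslope : ∀ i j, i ≠ j → (slope i - slope j : ℂ) ≠ 0 := by
    intro i j hij h0
    exact hij (slope_injective (by exact_mod_cast sub_eq_zero.1 h0))
  have hΔ0 : Δ ≠ 0 := by
    intro h0
    have h1 : ∀ j, j ≠ 0 → Q j = 0 := by
      intro j hj
      have h2 := hQΔ 0 j
      rw [h0, mul_zero] at h2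
      exact ((mul_eq_zero.1 ((mul_eq_zero.1 h2).resolve_left
        (sub_ne_zero.2 (hε0 j hj)))).resolve_left hQ0)
    have h2 := h1 1 (by decide)
    have h3 := h1 2 (by decide)
    simp only [hQ] at h2 h3
    have hB0 : B' = 0 := by
      refine (mul_eq_zero.1 (?_ : (slope 1 - slope 2 : ℂ) * B' = 0)).resolve_left
        (hslope 1 2 (by decide))
      linear_combination h3 - h2
    apply hQ0
    simp only [hQ]
    rw [hB0] at h2 ⊢
    linear_combination h2
  have hεne : ∀ i j, i ≠ j → ε i ≠ ε j := by
    intro i j hij heq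
    have h1 := hQΔ i j
    rw [heq, sub_self, zero_mul] at h1
    exact mul_ne_zero (hslope i j hij) hΔ0 h1.symm
  have hQne : ∀ j, Q j ≠ 0 := by
    intro j
    by_cases hj : j = 0
    · exact hj ▸ hQ0
    · intro h0
      have h1 := hQΔ 0 j
      rw [h0, mul_zero, mul_zero] at h1
      exact mul_ne_zero (hslope 0 j (Ne.symm hj)) hΔ0 h1.symm
  have hεM : ∀ j, ε j ^ M = 1 := by
    intro j
    rw [hε]
    dsimp only
    rw [← pow_mul, mul_comm, pow_mul, hprim.pow_eq_one, one_pow]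
  refine crossRatio_ne hM0 (hεM 0) (hεM 1) (hεM 2) (hεM 3) (hεne 0 2 (by decide))
    (hεne 1 3 (by decide)) ?_
  have hprod : Q 0 * Q 1 * Q 2 * Q 3 ≠ 0 := by
    simp [hQne]
  apply mul_left_cancel₀ hprod
  have e02 := hQΔ 0 2
  have e13 := hQΔ 1 3
  have e03 := hQΔ 0 3
  have e12 := hQΔ 1 2
  simp only [slope, Matrix.cons_val] at e02 e13 e03 e12
  simp only [Complex.ofReal_add, Complex.ofReal_sub, Complex.ofReal_neg, Complex.ofReal_mul,
    Complex.ofReal_one, Complex.ofReal_ofNat] at e02 e13 e03 e12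
  set τ : ℂ := (Real.goldenRatio : ℂ)
  have e1 : Q 0 * Q 1 * Q 2 * Q 3 * ((ε 0 - ε 3) * (ε 1 - ε 2)) =
      (1 + 3 * τ) * (2 * τ - 1) * Δ ^ 2 := by
    calc _ = ((ε 0 - ε 3) * (Q 0 * Q 3)) * ((ε 1 - ε 2) * (Q 1 * Q 2)) := by ring
      _ = _ := by rw [e03, e12]; ring
  have e2 : Q 0 * Q 1 * Q 2 * Q 3 * ((ε 0 - ε 2) * (ε 1 - ε 3)) =
      (1 + 2 * τ) * (3 * τ - 1) * Δ ^ 2 := by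
    calc _ = ((ε 0 - ε 2) * (Q 0 * Q 2)) * ((ε 1 - ε 3) * (Q 1 * Q 3)) := by ring
      _ = _ := by rw [e02, e13]; ring
  linear_combination ((1 + 2 * τ) * (3 * τ - 1)) * e1 - ((1 + 3 * τ) * (2 * τ - 1)) * e2

/-! ### Convex sets with equal X-rays in four directions -/

lemma zeta5_im_pos : 0 < zeta5.im := by
  have h : zeta5 = Complex.exp ((2 * Real.pi / 5 : ℝ) * Complex.I) := by
    rw [zeta5]; congr 1; push_cast; ring
  rw [h, Complex.exp_ofReal_mul_I_im]
  have := Real.pi_pos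
  exact Real.sin_pos_of_pos_of_lt_pi (by positivity) (by linarith)

/-- The coordinate of `ζ₅` in the real basis `1`, `ζ₅` of `ℂ`. -/
noncomputable def coordT (z : ℂ) : ℝ := z.im / zeta5.im

/-- The coordinate of `1` in the real basis `1`, `ζ₅` of `ℂ`. -/
noncomputable def coordS (z : ℂ) : ℝ := z.re - coordT z * zeta5.re

lemma coord_eq (z : ℂ) : z = coordS z + coordT z * zeta5 := by
  have h := zeta5_im_pos.ne'
  apply Complex.ext <;> simp [coordS, coordT, h]

lemma coordT_add_mul (s t : ℝ) : coordT (s + t * zeta5) = t := by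
  have h := zeta5_im_pos.ne'
  simp [coordT, h]

lemma coordS_add_mul (s t : ℝ) : coordS (s + t * zeta5) = s := by
  have h := zeta5_im_pos.ne'
  simp [coordS, coordT_add_mul]

/-- The functional whose level sets are the lines in the `j`-th direction. -/
noncomputable def lineCoord (j : Fin 4) (z : ℂ) : ℝ := coordS z - slope j * coordT z

lemma lineCoord_eq_iff {j : Fin 4} {u : ℂ} {ρ : ℝ} (hρ : ρ ≠ 0) (hu : u = ρ * (slope j + zeta5))
    (z p : ℂ) : (∃ s : ℝ, z = p + s * u) ↔ lineCoord j z = lineCoord j p := by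
  unfold lineCoord
  constructor
  · rintro ⟨s, rfl⟩
    have h : p + s * u = ((coordS p + s * ρ * slope j : ℝ) : ℂ) +
        ((coordT p + s * ρ : ℝ) : ℂ) * zeta5 := by
      rw [hu]
      nth_rewrite 1 [coord_eq p]
      push_cast
      ring
    rw [h, coordS_add_mul, coordT_add_mul]
    ring
  · intro h
    refine ⟨(coordT z - coordT p) / ρ, ?_⟩
    have hρ' : (ρ : ℂ) ≠ 0 := by exact_mod_cast hρ
    have h' : (coordS z : ℂ) - slope j * coordT z = coordS p - slope j * coordT p := by
      exact_mod_cast h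
    rw [hu]
    nth_rewrite 1 [coord_eq z]
    nth_rewrite 1 [coord_eq p]
    push_cast
    field_simp
    linear_combination h'

/-- Equal numbers of positive and negative points on every line give a matching. -/
lemma exists_perm_isMatching {D : Type*} [Finite D] (sgn : D → Bool) (y : D → ℝ)
    (h : ∀ l, Nat.card {p // sgn p = true ∧ y p = l} = Nat.card {p // sgn p = false ∧ y p = l}) :
    ∃ ψ : Equiv.Perm D, IsMatching sgn y ψ := by
  have hcard : ∀ v : Bool × ℝ,
      Nat.card {p // (sgn p, y p) = v} = Nat.card {p // (!sgn p, y p) = v} := by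
    rintro ⟨b, l⟩
    cases b
    · simpa using (h l).symm
    · simpa using h l
  let e : ∀ v : Bool × ℝ, {p // (sgn p, y p) = v} ≃ {p // (!sgn p, y p) = v} := fun v =>
    (Finite.card_eq.1 (hcard v)).some
  have he := Equiv.ofFiberEquiv_map (f := fun p => (sgn p, y p)) (g := fun p => (!sgn p, y p)) e
  refine ⟨Equiv.ofFiberEquiv e, fun p => ?_, fun p => ?_⟩
  · have h1 : (!sgn (Equiv.ofFiberEquiv e p)) = sgn p := congrArg Prod.fst (he p)
    rw [← h1]
    exact (Bool.not_ne_self _).symm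
  · exact congrArg Prod.snd (he p)

lemma mem_convexHull_of_weights {K : Set ℂ} {p q r s : ℂ} (hq : q ∈ K) (hr : r ∈ K) (hs : s ∈ K)
    {a b c : ℝ} (ha : 0 ≤ a) (hb : 0 ≤ b) (hc : 0 ≤ c) (habc : 0 < a + b + c)
    (h : (a : ℂ) * (q - p) + b * (r - p) + c * (s - p) = 0) : p ∈ convexHull ℝ K := by
  have hsum := (convex_convexHull ℝ K).sum_mem (t := Finset.univ)
    (w := ![a / (a + b + c), b / (a + b + c), c / (a + b + c)]) (z := ![q, r, s])
    (by intro i _; fin_cases i <;> simp <;> positivity)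
    (by simp [Fin.sum_univ_three]; field_simp)
    (by
      intro i _
      fin_cases i
      exacts [subset_convexHull ℝ K hq, subset_convexHull ℝ K hr, subset_convexHull ℝ K hs])
  convert hsum using 1
  have h0 : (a + b + c : ℂ) ≠ 0 := by exact_mod_cast habc.ne'
  simp [Fin.sum_univ_three]
  field_simp
  linear_combination -h

lemma noMixedHull_of_mem_convexSubsets {Λ F F' : Set ℂ} (hF : F ∈ convexSubsets Λ)
    (hF' : F' ∈ convexSubsets Λ) (sgn : ↥(symmDiff F F') → Bool)
    (hsgn : ∀ p, sgn p = true ↔ (p : ℂ) ∈ F) :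
    NoMixedHull sgn (fun p => coordS p) (fun p => coordT p) := by
  have hfalse : ∀ p, sgn p = false ↔ (p : ℂ) ∈ F' := by
    rintro ⟨p, hp⟩
    rw [← Bool.not_eq_true, hsgn]
    rw [Set.mem_symmDiff] at hp
    dsimp only
    tauto
  intro p q r s hq hr hs a b c ha hb hc habc h1 h2
  have hcomb : (a : ℂ) * ((q : ℂ) - p) + b * ((r : ℂ) - p) + c * ((s : ℂ) - p) = 0 := by
    have h1' : (a : ℂ) * (coordS q - coordS p) + b * (coordS r - coordS p) +
        c * (coordS s - coordS p) = 0 := by exact_mod_cast h1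
    have h2' : (a : ℂ) * (coordT q - coordT p) + b * (coordT r - coordT p) +
        c * (coordT s - coordT p) = 0 := by exact_mod_cast h2
    rw [coord_eq q, coord_eq r, coord_eq s, coord_eq p]
    linear_combination h1' + zeta5 * h2'
  have hp := Set.mem_symmDiff.1 p.2
  cases hpb : sgn p
  · simp only [hpb, ne_eq, Bool.not_eq_false, hsgn] at hq hr hs
    have hpF' := (hfalse p).1 hpb
    have hmem := mem_convexHull_of_weights hq hr hs ha hb hc habc hcomb
    have hpF : (p : ℂ) ∈ F := hF.2.2.ge ⟨hmem, hF'.2.1 hpF'⟩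
    tauto
  · simp only [hpb, ne_eq, Bool.not_eq_true, hfalse] at hq hr hs
    have hpF := (hsgn p).1 hpb
    have hmem := mem_convexHull_of_weights hq hr hs ha hb hc habc hcomb
    have hpF' : (p : ℂ) ∈ F' := hF'.2.2.ge ⟨hmem, hF.2.1 hpF⟩
    tauto

/-- The convex subsets of any set of points in the plane are determined by the X-rays in the four
directions. -/
theorem determined_convexSubsets (Λ : Set ℂ) {U : Set Circle} (u : Fin 4 → Circle)
    (hu : ∀ j, u j ∈ U) (hslope : ∀ j, ∃ ρ : ℝ, ρ ≠ 0 ∧ (u j : ℂ) = ρ * (slope j + zeta5)) :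
    Determined (convexSubsets Λ) U := by
  intro F hF F' hF' hX
  by_contra hne
  have hfin : (symmDiff F F').Finite := hF.1.symmDiff hF'.1
  have hnonempty : (symmDiff F F').Nonempty := by
    rw [Set.nonempty_iff_ne_empty]
    intro h
    exact hne (symmDiff_eq_bot.1 h)
  have : Fintype ↥(symmDiff F F') := hfin.fintype
  have : Nonempty ↥(symmDiff F F') := hnonempty.to_subtype
  classical
  let sgn : ↥(symmDiff F F') → Bool := fun p => decide ((p : ℂ) ∈ F)
  have hsgn : ∀ p, sgn p = true ↔ (p : ℂ) ∈ F := fun p => by simp [sgn]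
  have hmatch : ∀ j, ∃ ψ : Equiv.Perm ↥(symmDiff F F'),
      IsMatching sgn (fun p => coordS p - slope j * coordT p) ψ := by
    intro j
    apply exists_perm_isMatching
    intro l
    obtain ⟨ρ, hρ, hρu⟩ := hslope j
    set S : Set ℂ := {z | lineCoord j z = l} with hS
    have hline : {z : ℂ | ∃ s : ℝ, z = (l : ℂ) + s * (u j : ℂ)} = S := by
      ext z
      rw [Set.mem_ofPred_eq, lineCoord_eq_iff hρ hρu, hS, Set.mem_ofPred_eq]
      have h1 := coordS_add_mul l 0
      have h2 := coordT_add_mul l 0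
      simp only [Complex.ofReal_zero, zero_mul, add_zero] at h1 h2
      have h3 : lineCoord j (l : ℂ) = l := by rw [lineCoord, h1, h2]; ring
      rw [h3]
    have hcount : (F ∩ S).ncard = (F' ∩ S).ncard :=
      congrFun (hX (u j) (hu j)) ⟨S, (l : ℂ), hline.symm⟩
    have hdiff : ((F ∩ S) \ (F' ∩ S)).ncard = ((F' ∩ S) \ (F ∩ S)).ncard := by
      have h1 := Set.ncard_inter_add_ncard_sdiff_eq_ncard (F ∩ S) (F' ∩ S) (hF.1.inter_of_left S)
      have h2 := Set.ncard_inter_add_ncard_sdiff_eq_ncard (F' ∩ S) (F ∩ S) (hF'.1.inter_of_left S)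
      rw [Set.inter_comm (F' ∩ S) (F ∩ S)] at h2
      omega
    have e1 : Nat.card {p : ↥(symmDiff F F') // sgn p = true ∧
        coordS p - slope j * coordT p = l} = ((F ∩ S) \ (F' ∩ S)).ncard := by
      rw [← Nat.card_coe_set_eq]
      refine Nat.card_congr ⟨fun p => ⟨p.1, ?_⟩, fun p => ⟨⟨p.1, ?_⟩, ?_⟩, fun _ => rfl,
        fun _ => rfl⟩
      · obtain ⟨⟨p, hp⟩, h1, h2⟩ := p
        rw [hsgn] at h1
        rw [Set.mem_symmDiff] at hp
        exact ⟨⟨h1, h2⟩, fun h3 => hp.elim (fun h => h.2 h3.1) (fun h => h.2 h1)⟩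
      · obtain ⟨p, ⟨h1, h2⟩, h3⟩ := p
        exact Or.inl ⟨h1, fun h4 => h3 ⟨h4, h2⟩⟩
      · obtain ⟨p, ⟨h1, h2⟩, h3⟩ := p
        exact ⟨(hsgn _).2 h1, h2⟩
    have e2 : Nat.card {p : ↥(symmDiff F F') // sgn p = false ∧
        coordS p - slope j * coordT p = l} = ((F' ∩ S) \ (F ∩ S)).ncard := by
      rw [← Nat.card_coe_set_eq]
      refine Nat.card_congr ⟨fun p => ⟨p.1, ?_⟩, fun p => ⟨⟨p.1, ?_⟩, ?_⟩, fun _ => rfl,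
        fun _ => rfl⟩
      · obtain ⟨⟨p, hp⟩, h1, h2⟩ := p
        rw [← Bool.not_eq_true, hsgn] at h1
        rw [Set.mem_symmDiff] at hp
        exact ⟨⟨by tauto, h2⟩, fun h3 => h1 h3.1⟩
      · obtain ⟨p, ⟨h1, h2⟩, h3⟩ := p
        exact Or.inr ⟨h1, fun h4 => h3 ⟨h4, h2⟩⟩
      · obtain ⟨p, ⟨h1, h2⟩, h3⟩ := p
        refine ⟨?_, h2⟩
        rw [← Bool.not_eq_true, hsgn]
        exact fun h4 => h3 ⟨h4, h2⟩
    rw [e1, e2, hdiff]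
  choose ψ hψ using hmatch
  exact no_matching_four (noMixedHull_of_mem_convexSubsets hF hF' sgn hsgn) ψ hψ

/-! ### The four directions -/

lemma goldenRatio_eq : (Real.goldenRatio : ℂ) = -(zeta5 ^ 2 + zeta5 ^ 3) := by
  have h5 := zeta5_isPrimitiveRoot.pow_eq_one
  have h2 : zeta5 ^ 2 = Complex.exp ((Real.pi - Real.pi / 5 : ℝ) * Complex.I) := by
    rw [zeta5, ← Complex.exp_nat_mul]; congr 1; push_cast; ring
  have h3 : zeta5 ^ 3 = Complex.exp (-((Real.pi - Real.pi / 5 : ℝ) * Complex.I)) := by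
    rw [Complex.exp_neg, ← h2]
    apply eq_inv_of_mul_eq_one_left
    rw [← pow_add, h5]
  have h4 := Complex.two_cos ((Real.pi - Real.pi / 5 : ℝ) : ℂ)
  rw [neg_mul, ← h2, ← h3, ← Complex.ofReal_cos, Real.cos_pi_sub, Real.cos_pi_div_five] at h4
  rw [← h4, Real.goldenRatio]
  push_cast
  ring

lemma goldenRatio_mem : (Real.goldenRatio : ℂ) ∈ Zzeta5 := by
  have h : zeta5 ∈ Zzeta5 := Algebra.subset_adjoin rfl
  rw [goldenRatio_eq]
  exact neg_mem (add_mem (pow_mem h 2) (pow_mem h 3))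

/-- The four elements as a family. -/
noncomputable def fourFamily (j : Fin 4) : ℂ := ![1, 1, 1, -1] j * (slope j + zeta5)

lemma range_fourFamily : Set.range fourFamily = fourElements := by
  have h0 : fourFamily 0 = 1 + (Real.goldenRatio : ℂ) + zeta5 := by simp [fourFamily, slope]
  have h1 : fourFamily 1 = (Real.goldenRatio : ℂ) - 1 + zeta5 := by simp [fourFamily, slope]
  have h2 : fourFamily 2 = -(Real.goldenRatio : ℂ) + zeta5 := by simp [fourFamily, slope]
  have h3 : fourFamily 3 = 2 * (Real.goldenRatio : ℂ) - zeta5 := by simp [fourFamily, slope]; ring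
  ext z
  simp only [Set.mem_range, fourElements, Set.mem_insert_iff, Set.mem_singleton_iff,
    Fin.exists_fin_succ]
  simp [h0, h1, h2, h3, eq_comm]

lemma fourFamily_sign (j : Fin 4) : ∃ σ : ℝ, σ ≠ 0 ∧ fourFamily j = σ * (slope j + zeta5) := by
  fin_cases j
  · exact ⟨1, by norm_num, by simp [fourFamily]⟩
  · exact ⟨1, by norm_num, by simp [fourFamily]⟩
  · exact ⟨1, by norm_num, by simp [fourFamily]⟩
  · exact ⟨-1, by norm_num, by simp [fourFamily]⟩

lemma slope_add_zeta5_ne_zero (r : ℝ) : (r + zeta5 : ℂ) ≠ 0 := by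
  intro h
  have h1 := congrArg Complex.im h
  simp [zeta5_im_pos.ne'] at h1

lemma fourFamily_ne_zero (j : Fin 4) : fourFamily j ≠ 0 := by
  obtain ⟨σ, hσ, h⟩ := fourFamily_sign j
  rw [h]
  exact mul_ne_zero (by exact_mod_cast hσ) (slope_add_zeta5_ne_zero _)

lemma fourFamily_mem (j : Fin 4) : fourFamily j ∈ Zzeta5 := by
  have hζ : zeta5 ∈ Zzeta5 := Algebra.subset_adjoin rfl
  have hτ := goldenRatio_mem
  have h : fourFamily j ∈ fourElements := range_fourFamily ▸ Set.mem_range_self j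
  simp only [fourElements, Set.mem_insert_iff, Set.mem_singleton_iff] at h
  rcases h with h | h | h | h <;> rw [h]
  · exact add_mem (add_mem (one_mem _) hτ) hζ
  · exact add_mem (sub_mem hτ (one_mem _)) hζ
  · exact add_mem (neg_mem hτ) hζ
  · exact sub_mem (mul_mem (ofNat_mem _ 2) hτ) hζ

/-- The point `z / |z|` of the unit circle. -/
noncomputable def direction (z : ℂ) (hz : z ≠ 0) : Circle :=
  ⟨z / (‖z‖ : ℂ), by
    refine mem_sphere_zero_iff_norm.2 ?_
    rw [norm_div, Complex.norm_real, norm_norm, div_self (norm_ne_zero_iff.2 hz)]⟩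

/-- The four directions as a family. -/
noncomputable def fourDirection (j : Fin 4) : Circle :=
  direction (fourFamily j) (fourFamily_ne_zero j)

lemma coe_fourDirection (j : Fin 4) :
    (fourDirection j : ℂ) = fourFamily j / (‖fourFamily j‖ : ℂ) := rfl

lemma range_fourDirection : Set.range fourDirection = fourDirections := by
  ext u
  simp only [fourDirections, ← range_fourFamily, Set.mem_range, Set.mem_ofPred_eq]
  constructor
  · rintro ⟨j, rfl⟩
    exact ⟨_, ⟨j, rfl⟩, coe_fourDirection j⟩
  · rintro ⟨_, ⟨j, rfl⟩, h⟩
    exact ⟨j, Circle.ext (h.symm ▸ coe_fourDirection j)⟩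

lemma fourDirection_eq (j : Fin 4) :
    ∃ ρ : ℝ, ρ ≠ 0 ∧ (fourDirection j : ℂ) = ρ * (slope j + zeta5) := by
  obtain ⟨σ, hσ, h⟩ := fourFamily_sign j
  refine ⟨σ / ‖fourFamily j‖, div_ne_zero hσ (norm_ne_zero_iff.2 (fourFamily_ne_zero j)), ?_⟩
  rw [coe_fourDirection]
  nth_rewrite 1 [h]
  push_cast
  ring

lemma not_parallel_fourDirection {i j : Fin 4} (hij : i ≠ j) :
    ¬ Parallel (fourDirection i : ℂ) (fourDirection j : ℂ) := by
  rintro ⟨r, -, h⟩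
  obtain ⟨ρ, hρ, h1⟩ := fourDirection_eq i
  obtain ⟨σ, hσ, h2⟩ := fourDirection_eq j
  rw [h1, h2] at h
  have h3 : ((ρ * slope i : ℝ) : ℂ) + (ρ : ℝ) * zeta5 =
      ((r * σ * slope j : ℝ) : ℂ) + ((r * σ : ℝ) : ℂ) * zeta5 := by
    push_cast
    linear_combination h
  have h4 := congrArg coordT h3
  have h5 := congrArg coordS h3
  rw [coordT_add_mul, coordT_add_mul] at h4
  rw [coordS_add_mul, coordS_add_mul, ← h4] at h5
  exact hij (slope_injective (mul_left_cancel₀ hρ h5))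

lemma encard_fourDirections : fourDirections.encard = 4 := by
  have hinj : Function.Injective fourDirection := by
    intro i j hij
    by_contra hne
    exact not_parallel_fourDirection hne ⟨1, one_ne_zero, by simp [hij]⟩
  rw [← range_fourDirection, ← Set.image_univ, hinj.encard_image, Set.encard_univ]
  simp

lemma nonparallel_fourDirections : NonparallelZzeta5Directions fourDirections := by
  rw [← range_fourDirection]
  constructor
  · rintro _ ⟨j, rfl⟩
    refine ⟨fourFamily j, fourFamily_mem j, fourFamily_ne_zero j, ‖fourFamily j‖⁻¹,
      inv_ne_zero (norm_ne_zero_iff.2 (fourFamily_ne_zero j)), ?_⟩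
    rw [coe_fourDirection]
    push_cast
    ring
  · rintro _ ⟨i, rfl⟩ _ ⟨j, rfl⟩ hij
    exact not_parallel_fourDirection fun h => hij (congrArg _ h)

lemma determined_fourDirections (Λ : Set ℂ) : Determined (convexSubsets Λ) fourDirections :=
  determined_convexSubsets Λ fourDirection
    (fun j => range_fourDirection ▸ Set.mem_range_self j) fourDirection_eq

/-! ### Hexagons with sides in three directions -/

/-- The signed area of the parallelogram spanned by `a` and `b`, as a linear form in `b`. -/
noncomputable def cross (a : ℂ) : ℂ →ₗ[ℝ] ℝ where
  toFun b := a.re * b.im - a.im * b.re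
  map_add' b c := by simp; ring
  map_smul' r b := by simp; ring

lemma cross_apply (a b : ℂ) : cross a b = a.re * b.im - a.im * b.re := rfl

lemma cross_real_mul (r s : ℝ) (a b : ℂ) : cross (r * a) (s * b) = r * s * cross a b := by
  simp [cross_apply]; ring

lemma cross_combination (a b w : ℂ) :
    (cross a b : ℂ) * w = -(cross b w : ℂ) * a + (cross a w : ℂ) * b := by
  apply Complex.ext <;> simp [cross_apply] <;> ring

lemma Parallel.symm {w z : ℂ} (h : Parallel w z) : Parallel z w := by
  obtain ⟨r, hr, rfl⟩ := h
  refine ⟨r⁻¹, inv_ne_zero hr, ?_⟩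
  have : (r : ℂ) ≠ 0 := by exact_mod_cast hr
  push_cast
  field_simp

lemma Parallel.trans {v w z : ℂ} (h : Parallel v w) (h' : Parallel w z) : Parallel v z := by
  obtain ⟨r, hr, rfl⟩ := h
  obtain ⟨s, hs, rfl⟩ := h'
  exact ⟨r * s, mul_ne_zero hr hs, by push_cast; ring⟩

lemma parallel_real_mul {r : ℝ} (hr : r ≠ 0) (z : ℂ) : Parallel z (r * z) :=
  Parallel.symm ⟨r, hr, rfl⟩

lemma parallel_of_cross_eq_zero {a b : ℂ} (ha : a ≠ 0) (hb : b ≠ 0) (h : cross a b = 0) :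
    Parallel a b := by
  have h1 := cross_combination a b (Complex.I * a)
  rw [h, Complex.ofReal_zero, zero_mul] at h1
  have h2 : cross a (Complex.I * a) ≠ 0 := by
    have h3 : cross a (Complex.I * a) = Complex.normSq a := by
      simp [cross_apply, Complex.normSq_apply]
    rw [h3]
    exact (Complex.normSq_pos.2 ha).ne'
  have h2' : (cross a (Complex.I * a) : ℂ) ≠ 0 := by exact_mod_cast h2
  have h4 : cross b (Complex.I * a) ≠ 0 := by
    intro h4
    rw [h4] at h1
    simp at h1
    tauto
  have h4' : (cross b (Complex.I * a) : ℂ) ≠ 0 := by exact_mod_cast h4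
  refine ⟨cross a (Complex.I * a) / cross b (Complex.I * a), div_ne_zero h2 h4, ?_⟩
  push_cast
  rw [div_mul_eq_mul_div, eq_div_iff h4']
  linear_combination h1

lemma inter_mem_convexSubsets {Λ G : Set ℂ} (hG : Convex ℝ G) (hfin : (G ∩ Λ).Finite) :
    G ∩ Λ ∈ convexSubsets Λ := by
  refine ⟨hfin, Set.inter_subset_right, Set.Subset.antisymm ?_ ?_⟩
  · exact fun x hx => ⟨subset_convexHull ℝ _ hx, hx.2⟩
  · exact fun x hx => ⟨convexHull_min Set.inter_subset_left hG hx.1, hx.2⟩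

/-- If the vertices `c ± zᵢ` of a hexagon belong to `Λ`, then removing every second vertex from the
set of points of `Λ` in the hexagon gives two convex subsets with the same X-rays in the directions
of `z₀, z₁, z₂`. -/
theorem not_determined_of_hexagon {Λ : Set ℂ} {U : Set Circle} {c : ℂ} {z : Fin 3 → ℂ}
    (hsum : z 0 + z 1 + z 2 = 0) (hcross : cross (z 0) (z 1) ≠ 0)
    (hfin : ∀ R : ℝ, (Λ ∩ Metric.closedBall c R).Finite)
    (hadd : ∀ i, c + z i ∈ Λ) (hsub : ∀ i, c - z i ∈ Λ)
    (hU : ∀ u ∈ U, ∃ i, Parallel (u : ℂ) (z i)) :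
    ¬ Determined (convexSubsets Λ) U := by
  set d := cross (z 0) (z 1) with hd
  have hz2 : z 2 = -z 0 - z 1 := by linear_combination hsum
  let l : Fin 3 → ℂ →ₗ[ℝ] ℝ := fun i => d⁻¹ • cross (z i)
  -- `l i` vanishes at `z i` and takes the values `1` and `-1` at the two following vectors
  have hl : ∀ i j, l i (z j) = if j = i then 0 else if j = i + 1 then 1 else -1 := by
    have e0 : cross (z 0) (z 1) * d⁻¹ = 1 := mul_inv_cancel₀ hcross
    simp only [cross_apply] at e0
    intro i j
    fin_cases i <;> fin_cases j <;>
      simp [l, cross_apply, hz2, -mul_eq_zero] <;>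
      first | linear_combination e0 | linear_combination -e0 | linear_combination (0 : ℝ) * e0
  have hl2 : ∀ w, l 0 w + l 1 w + l 2 w = 0 := by
    intro w
    simp only [l, cross_apply, LinearMap.smul_apply, hz2, smul_eq_mul]
    simp
    ring
  have hcomb : ∀ w, w = -(l 1 w : ℂ) * z 0 + (l 0 w : ℂ) * z 1 := by
    intro w
    have hd' : (d : ℂ) ≠ 0 := by exact_mod_cast hcross
    have := cross_combination (z 0) (z 1) w
    simp only [l, LinearMap.smul_apply, smul_eq_mul]
    push_cast
    field_simp
    linear_combination this
  let H : Set ℂ := {x | ∀ i, |l i (x - c)| ≤ 1}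
  have hdet : ∀ w v, (∀ i, l i w = l i v) → w = v := by
    intro w v h
    rw [hcomb w, hcomb v, h 0, h 1]
  have hHball : H ⊆ Metric.closedBall c (‖z 0‖ + ‖z 1‖) := by
    intro x hx
    rw [mem_closedBall_iff_norm, hcomb (x - c)]
    have h0 := hx 0
    have h1 := hx 1
    refine (norm_add_le _ _).trans (add_le_add ?_ ?_)
    · rw [norm_mul, norm_neg, Complex.norm_real, Real.norm_eq_abs]
      exact mul_le_of_le_one_left (norm_nonneg _) h1
    · rw [norm_mul, Complex.norm_real, Real.norm_eq_abs]
      exact mul_le_of_le_one_left (norm_nonneg _) h0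
  have hHfin : (H ∩ Λ).Finite :=
    (hfin (‖z 0‖ + ‖z 1‖)).subset fun x hx => ⟨hx.2, hHball hx.1⟩
  have hHadd : ∀ i, c + z i ∈ H := by
    intro i j
    rw [add_sub_cancel_left, hl]
    split_ifs <;> simp
  have hHsub : ∀ i, c - z i ∈ H := by
    intro i j
    rw [show c - z i - c = -z i by ring, map_neg, hl]
    split_ifs <;> simp
  -- the supporting functionals at the vertices
  let m : Fin 3 → ℂ →ₗ[ℝ] ℝ := fun i => l (i + 1) - l (i + 2)
  have hm : ∀ i, m i (z i) = -2 := by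
    intro i
    fin_cases i <;> simp [m, hl] <;> norm_num
  have hmax : ∀ i, ∀ x ∈ H, (m i (x - c) < 2 ↔ x ≠ c - z i) ∧ (-2 < m i (x - c) ↔ x ≠ c + z i) := by
    intro i x hx
    have h1 := abs_le.1 (hx (i + 1))
    have h2 := abs_le.1 (hx (i + 2))
    have h3 : m i (x - c) = l (i + 1) (x - c) - l (i + 2) (x - c) := rfl
    have h4 : l i (x - c) + l (i + 1) (x - c) + l (i + 2) (x - c) = 0 := by
      rw [← hl2 (x - c)]
      fin_cases i <;> simp <;> ring
    have hall : ∀ w v, l (i + 1) w = l (i + 1) v → l (i + 2) w = l (i + 2) v →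
        l i w = l i v → w = v := by
      intro w v e1 e2 e3
      refine hdet w v fun j => ?_
      revert e1 e2 e3
      fin_cases i <;> fin_cases j <;> simp <;> tauto
    constructor
    · constructor
      · rintro h rfl
        rw [show c - z i - c = -z i by ring, map_neg, hm] at h
        norm_num at h
      · intro hne
        by_contra hge
        apply hne
        have e : x - c = -z i := by
          apply hall <;> rw [map_neg, hl]
          · have : l (i + 1) (x - c) = 1 := by linarith
            rw [this]
            fin_cases i <;> simp
          · have : l (i + 2) (x - c) = -1 := by linarith
            rw [this]
            fin_cases i <;> simp
          · have : l i (x - c) = 0 := by linarith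
            rw [this]
            simp
        linear_combination e
    · constructor
      · rintro h rfl
        rw [add_sub_cancel_left, hm] at h
        norm_num at h
      · intro hne
        by_contra hge
        apply hne
        have e : x - c = z i := by
          apply hall <;> rw [hl]
          · have : l (i + 1) (x - c) = -1 := by linarith
            rw [this]
            fin_cases i <;> simp
          · have : l (i + 2) (x - c) = 1 := by linarith
            rw [this]
            fin_cases i <;> simp
          · have : l i (x - c) = 0 := by linarith
            rw [this]
            simp
        linear_combination e
  have hconvH : Convex ℝ H := by
    have : H = ⋂ i, ({x | l i x ≤ 1 + l i c} ∩ {x | -1 + l i c ≤ l i x}) := by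
      ext x
      simp only [H, Set.mem_ofPred_eq, Set.mem_iInter, Set.mem_inter_iff, abs_le, map_sub]
      refine forall_congr' fun i => ⟨fun h => ⟨?_, ?_⟩, fun h => ⟨?_, ?_⟩⟩ <;> linarith [h.1, h.2]
    rw [this]
    exact convex_iInter fun i => (convex_halfSpace_le (l i).isLinear _).inter
      (convex_halfSpace_ge (l i).isLinear _)
  have hG₁ : Convex ℝ (H \ Set.range fun i => c - z i) := by
    have : (H \ Set.range fun i => c - z i) = H ∩ ⋂ i, {x | m i x < 2 + m i c} := by
      ext x
      simp only [Set.mem_sdiff, Set.mem_inter_iff, Set.mem_iInter, Set.mem_range, not_exists,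
        Set.mem_ofPred_eq]
      refine and_congr_right fun hx => forall_congr' fun i => ?_
      rw [← ne_eq, ne_comm, ← (hmax i x hx).1, map_sub, sub_lt_iff_lt_add]
    rw [this]
    exact hconvH.inter (convex_iInter fun i => convex_halfSpace_lt (m i).isLinear _)
  have hG₂ : Convex ℝ (H \ Set.range fun i => c + z i) := by
    have : (H \ Set.range fun i => c + z i) = H ∩ ⋂ i, {x | -2 + m i c < m i x} := by
      ext x
      simp only [Set.mem_sdiff, Set.mem_inter_iff, Set.mem_iInter, Set.mem_range, not_exists,
        Set.mem_ofPred_eq]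
      refine and_congr_right fun hx => forall_congr' fun i => ?_
      rw [← ne_eq, ne_comm, ← (hmax i x hx).2, map_sub, lt_sub_iff_add_lt]
    rw [this]
    exact hconvH.inter (convex_iInter fun i => convex_halfSpace_gt (m i).isLinear _)
  have hz0 : ∀ i, z 0 + z i ≠ 0 := by
    intro i h
    have h1 := congrArg (l 0) h
    have h2 := congrArg (l 1) h
    rw [map_add, map_zero, hl, hl] at h1 h2
    revert h1 h2
    fin_cases i <;> simp
  intro hdetermined
  have heq := hdetermined _ (inter_mem_convexSubsets hG₁ (hHfin.subset
    (Set.inter_subset_inter_left _ Set.sdiff_subset))) _ (inter_mem_convexSubsets hG₂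
    (hHfin.subset (Set.inter_subset_inter_left _ Set.sdiff_subset))) ?_
  · have h1 : c + z 0 ∈ (H \ Set.range fun i => c - z i) ∩ Λ := by
      refine ⟨⟨hHadd 0, ?_⟩, hadd 0⟩
      rintro ⟨i, hi⟩
      exact hz0 i (by simp only at hi; linear_combination -hi)
    rw [heq] at h1
    exact h1.1.2 ⟨0, rfl⟩
  · intro u hu
    obtain ⟨i, ρ, hρ, hui⟩ := hU u hu
    funext L
    obtain ⟨L, p, rfl⟩ := L
    set L : Set ℂ := {x | ∃ s : ℝ, x = p + (s : ℂ) * (u : ℂ)} with hL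
    change (_ ∩ L).ncard = (_ ∩ L).ncard
    -- every line contains as many vertices of one kind as of the other
    have hshift : ∀ (x : ℂ) (r : ℝ), x + r * z i ∈ L ↔ x ∈ L := by
      have hρ' : (ρ : ℂ) ≠ 0 := by exact_mod_cast hρ
      intro x r
      constructor
      · rintro ⟨s, hs⟩
        refine ⟨s - r / ρ, ?_⟩
        push_cast
        rw [hui] at hs ⊢
        field_simp
        linear_combination hs
      · rintro ⟨s, hs⟩
        refine ⟨s + r / ρ, ?_⟩
        push_cast
        rw [hui] at hs ⊢
        field_simp
        linear_combination hs
    obtain ⟨π, hπ⟩ : ∃ π : Equiv.Perm (Fin 3), ∀ k, ∃ r : ℝ, c + z k = c - z (π k) + r * z i := by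
      refine ⟨Equiv.swap (i + 1) (i + 2), fun k => ?_⟩
      by_cases hk : k = i
      · refine ⟨2, ?_⟩
        rw [Equiv.swap_apply_of_ne_of_ne, hk]
        · push_cast; ring
        · rw [hk]; fin_cases i <;> decide
        · rw [hk]; fin_cases i <;> decide
      · refine ⟨-1, ?_⟩
        have : z k + z (Equiv.swap (i + 1) (i + 2) k) = -z i := by
          have hswap : ∀ i k : Fin 3, k ≠ i →
              Equiv.swap (i + 1) (i + 2) k ≠ k ∧ Equiv.swap (i + 1) (i + 2) k ≠ i := by decide
          obtain ⟨h1, h2⟩ := hswap i k hk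
          generalize Equiv.swap (i + 1) (i + 2) k = k' at h1 h2
          clear_value L
          fin_cases i <;> fin_cases k <;> fin_cases k' <;> simp at h1 h2 hk ⊢ <;>
            linear_combination hsum
        push_cast
        linear_combination this
    have hinj : Function.Injective z := by
      intro j k hjk
      by_contra hne
      have h1 := hl j k
      rw [← hjk, hl, if_pos rfl, if_neg (Ne.symm hne)] at h1
      split_ifs at h1 <;> norm_num at h1
    have hVcard : ((Set.range fun k => c - z k) ∩ L).ncard =
        ((Set.range fun k => c + z k) ∩ L).ncard := by
      have h1 : (Set.range fun k => c - z k) ∩ L = (fun k => c - z (π k)) '' {k | c + z k ∈ L} := by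
        ext x
        constructor
        · rintro ⟨⟨k, rfl⟩, hk⟩
          obtain ⟨r, hr⟩ := hπ (π.symm k)
          rw [Equiv.apply_symm_apply] at hr
          exact ⟨π.symm k, by rw [Set.mem_ofPred_eq, hr, hshift]; exact hk, by simp⟩
        · rintro ⟨k, hk, rfl⟩
          obtain ⟨r, hr⟩ := hπ k
          rw [Set.mem_ofPred_eq, hr, hshift] at hk
          exact ⟨⟨π k, rfl⟩, hk⟩
      have h2 : (Set.range fun k => c + z k) ∩ L = (fun k => c + z k) '' {k | c + z k ∈ L} := by
        ext x
        constructor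
        · rintro ⟨⟨k, rfl⟩, hk⟩
          exact ⟨k, hk, rfl⟩
        · rintro ⟨k, hk, rfl⟩
          exact ⟨⟨k, rfl⟩, hk⟩
      rw [h1, h2, Set.ncard_image_of_injective, Set.ncard_image_of_injective]
      · exact fun j k h => hinj (add_left_cancel h)
      · exact fun j k h => π.injective (hinj (sub_right_injective h))
    have hcount : ∀ V : Set ℂ, V ⊆ H ∩ Λ →
        ((H \ V) ∩ Λ ∩ L).ncard = (H ∩ Λ ∩ L).ncard - (V ∩ L).ncard := by
      intro V hV
      have h1 : (H \ V) ∩ Λ ∩ L = (H ∩ Λ ∩ L) \ (V ∩ L) := by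
        ext x
        simp only [Set.mem_inter_iff, Set.mem_sdiff]
        tauto
      rw [h1, Set.ncard_sdiff (Set.inter_subset_inter_left _ hV)
        ((hHfin.subset hV).inter_of_left _)]
    rw [hcount, hcount, hVcard]
    · rintro _ ⟨k, rfl⟩
      exact ⟨hHadd k, hadd k⟩
    · rintro _ ⟨k, rfl⟩
      exact ⟨hHsub k, hsub k⟩

/-! ### Arithmetic of `ℤ[ζ₅]` and the star map -/

lemma zeta5_pow_five : zeta5 ^ 5 = 1 := zeta5_isPrimitiveRoot.pow_eq_one

lemma zeta5_mem : zeta5 ∈ Zzeta5 := Algebra.subset_adjoin rfl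

lemma conj_zeta5 : (starRingEnd ℂ) zeta5 = zeta5 ^ 4 := by
  have h1 : ‖zeta5‖ = 1 := zeta5_isPrimitiveRoot.norm'_eq_one (by norm_num)
  rw [← Complex.inv_eq_conj h1]
  apply inv_eq_of_mul_eq_one_left
  rw [← pow_succ, zeta5_pow_five]

lemma norm_zeta5_pow (k : ℕ) : ‖zeta5 ^ k‖ = 1 := by
  rw [norm_pow, zeta5_isPrimitiveRoot.norm'_eq_one (by norm_num), one_pow]

/-- The first component `σ₂(z)` of the star map, in the coordinates of `z`. -/
noncomputable def sigma (a : Fin 4 → ℤ) : ℂ := ∑ j : Fin 4, (a j : ℂ) * (zeta5 ^ 2) ^ (j : ℕ)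

/-- The second component of the star map, in the coordinates of `z`. -/
def kappa (a : Fin 4 → ℤ) : ZMod 5 := ∑ j : Fin 4, (a j : ZMod 5)

lemma starMap_eq (a : Fin 4 → ℤ) : starMap a = (sigma a, kappa a) := rfl

lemma coordElt_add (a b : Fin 4 → ℤ) : coordElt (a + b) = coordElt a + coordElt b := by
  simp [coordElt, Fin.sum_univ_four]; ring

lemma sigma_add (a b : Fin 4 → ℤ) : sigma (a + b) = sigma a + sigma b := by
  simp [sigma, Fin.sum_univ_four]; ring

lemma kappa_add (a b : Fin 4 → ℤ) : kappa (a + b) = kappa a + kappa b := by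
  simp [kappa, Fin.sum_univ_four]; ring

lemma coordElt_smul (n : ℤ) (a : Fin 4 → ℤ) : coordElt (n • a) = n * coordElt a := by
  simp [coordElt, Fin.sum_univ_four]; ring

lemma sigma_smul (n : ℤ) (a : Fin 4 → ℤ) : sigma (n • a) = n * sigma a := by
  simp [sigma, Fin.sum_univ_four]; ring

lemma kappa_smul (n : ℤ) (a : Fin 4 → ℤ) : kappa (n • a) = n * kappa a := by
  simp [kappa, Fin.sum_univ_four]; ring

/-- Multiplication by `ζ₅` in coordinates. -/
def shift (a : Fin 4 → ℤ) : Fin 4 → ℤ := ![-a 3, a 0 - a 3, a 1 - a 3, a 2 - a 3]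

lemma coordElt_shift (a : Fin 4 → ℤ) : coordElt (shift a) = zeta5 * coordElt a := by
  simp [coordElt, shift, Fin.sum_univ_four]
  linear_combination (-(a 3 : ℂ)) * zeta5_pow_four

lemma sigma_shift (a : Fin 4 → ℤ) : sigma (shift a) = zeta5 ^ 2 * sigma a := by
  simp [sigma, shift, Fin.sum_univ_four]
  linear_combination (-(a 3 : ℂ)) * (zeta5 ^ 3 * zeta5_pow_five + zeta5_pow_four +
    zeta5 * zeta5_pow_five)

lemma goldenConj_eq : (Real.goldenConj : ℂ) = -(zeta5 ^ 4 + zeta5 ^ 6) := by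
  have h : (Real.goldenConj : ℂ) = 1 - Real.goldenRatio := by
    rw [← Real.one_sub_goldenConj]; push_cast; ring
  rw [h, goldenRatio_eq]
  linear_combination zeta5 * zeta5_pow_five + zeta5_pow_four

/-- Multiplication by `τ ^ n`, where `σ₂(τ) = 1 - τ`. -/
lemma exists_goldenRatio_pow_mul (n : ℕ) (a : Fin 4 → ℤ) : ∃ b : Fin 4 → ℤ,
    coordElt b = (Real.goldenRatio : ℂ) ^ n * coordElt a ∧
      sigma b = (Real.goldenConj : ℂ) ^ n * sigma a := by
  induction n with
  | zero => exact ⟨a, by simp, by simp⟩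
  | succ n ih =>
    obtain ⟨b, hb1, hb2⟩ := ih
    refine ⟨(-1 : ℤ) • (shift (shift b) + shift (shift (shift b))), ?_, ?_⟩
    · rw [coordElt_smul, coordElt_add]
      simp only [coordElt_shift]
      rw [hb1, pow_succ, goldenRatio_eq]
      push_cast
      ring
    · rw [sigma_smul, sigma_add]
      simp only [sigma_shift]
      rw [hb2, pow_succ, goldenConj_eq]
      push_cast
      ring

lemma exists_coord {z : ℂ} (hz : z ∈ Zzeta5) : ∃ a, coordElt a = z := by
  have h : z ∈ Set.range coordElt := range_coordElt ▸ hz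
  exact h

/-- The coordinates of `z` are bounded in terms of `z` and `σ₂(z)`, being the traces of
`z (ζ₅⁻ʲ - ζ₅) / 5`. -/
lemma five_mul_coord (a : Fin 4 → ℤ) (j : Fin 4) :
    (5 * a j : ℂ) = coordElt a * (zeta5 ^ (5 - (j : ℕ)) - zeta5) +
      (starRingEnd ℂ) (coordElt a) * (zeta5 ^ (j : ℕ) - zeta5 ^ 4) +
      sigma a * (zeta5 ^ (2 * (5 - (j : ℕ))) - zeta5 ^ 2) +
      (starRingEnd ℂ) (sigma a) * (zeta5 ^ (2 * (j : ℕ)) - zeta5 ^ 3) := by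
  have h4 := zeta5_pow_four
  have h5 := zeta5_pow_five
  simp only [coordElt, sigma, Fin.sum_univ_four, map_add, map_mul, map_pow, conj_zeta5,
    map_intCast, Fin.val_zero, Fin.val_one, Fin.val_two]
  generalize zeta5 = ζ at h4 h5 ⊢
  fin_cases j <;> simp <;>
    generalize (a 0 : ℂ) = x, (a 1 : ℂ) = y, (a 2 : ℂ) = z, (a 3 : ℂ) = w <;>
    clear * - h4 h5 <;> grind

/-- The points of a bounded set whose image under `σ₂` is bounded are finite in number. -/
lemma finite_coord (R S : ℝ) : {a : Fin 4 → ℤ | ‖coordElt a‖ ≤ R ∧ ‖sigma a‖ ≤ S}.Finite := by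
  refine (Set.finite_Icc (fun _ : Fin 4 => -⌈R + S⌉) (fun _ => ⌈R + S⌉)).subset ?_
  rintro a ⟨hR, hS⟩
  have hdiff : ∀ i j : ℕ, ‖zeta5 ^ i - zeta5 ^ j‖ ≤ 2 := by
    intro i j
    have := norm_sub_le (zeta5 ^ i) (zeta5 ^ j)
    rw [norm_zeta5_pow, norm_zeta5_pow] at this
    linarith
  have hbound : ∀ j, |(a j : ℝ)| ≤ R + S := by
    intro j
    have h1 := congrArg norm (five_mul_coord a j)
    have h2 : ‖(5 * a j : ℂ)‖ = 5 * |(a j : ℝ)| := by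
      rw [norm_mul, Complex.norm_intCast]; simp
    have h3 := hdiff (5 - (j : ℕ)) 1
    rw [pow_one] at h3
    have hR0 := norm_nonneg (coordElt a)
    have hS0 := norm_nonneg (sigma a)
    have h4 := norm_add₄_le (a := coordElt a * (zeta5 ^ (5 - (j : ℕ)) - zeta5))
      (b := (starRingEnd ℂ) (coordElt a) * (zeta5 ^ (j : ℕ) - zeta5 ^ 4))
      (c := sigma a * (zeta5 ^ (2 * (5 - (j : ℕ))) - zeta5 ^ 2))
      (d := (starRingEnd ℂ) (sigma a) * (zeta5 ^ (2 * (j : ℕ)) - zeta5 ^ 3))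
    rw [← h1, h2] at h4
    simp only [norm_mul, Complex.norm_conj] at h4
    have g1 := mul_le_mul_of_nonneg_left h3 hR0
    have g2 := mul_le_mul_of_nonneg_left (hdiff (j : ℕ) 4) hR0
    have g3 := mul_le_mul_of_nonneg_left (hdiff (2 * (5 - (j : ℕ))) 2) hS0
    have g4 := mul_le_mul_of_nonneg_left (hdiff (2 * (j : ℕ)) 3) hS0
    linarith
  constructor <;> intro j <;> have h := abs_le.1 (hbound j) <;> have h' := Int.le_ceil (R + S)
  · have : ((-⌈R + S⌉ : ℤ) : ℝ) ≤ a j := by push_cast; linarith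
    exact_mod_cast this
  · have : (a j : ℝ) ≤ (⌈R + S⌉ : ℤ) := by linarith
    exact_mod_cast this

/-! ### The windows -/

lemma pentagon_subset : pentagon ⊆ Metric.closedBall 0 1 := by
  refine convexHull_min (fun z hz => ?_) (convex_closedBall 0 1)
  rw [mem_closedBall_zero_iff]
  exact (Complex.norm_eq_one_of_pow_eq_one hz (by norm_num)).le

lemma goldenRatio_smul_pentagon_subset :
    Real.goldenRatio • pentagon ⊆ Metric.closedBall (0 : ℂ) 2 := by
  rintro _ ⟨z, hz, rfl⟩
  have h1 := mem_closedBall_zero_iff.1 (pentagon_subset hz)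
  rw [mem_closedBall_zero_iff]
  simp only [norm_smul, Real.norm_eq_abs]
  rw [abs_of_pos Real.goldenRatio_pos]
  have h2 := Real.goldenRatio_lt_two
  have h3 := Real.goldenRatio_pos
  nlinarith [norm_nonneg z]

lemma neg_subset_closedBall {A : Set ℂ} {r : ℝ} (h : A ⊆ Metric.closedBall 0 r) :
    -A ⊆ Metric.closedBall 0 r := by
  intro z hz
  have := h (Set.mem_neg.1 hz)
  rwa [mem_closedBall_zero_iff, norm_neg, ← mem_closedBall_zero_iff] at this

lemma window_subset {W : Fin 4 → Set ℂ} (hW : W = pentagons ∨ W = pentagons') (j : Fin 4) :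
    W j ⊆ Metric.closedBall 0 2 := by
  have h1 : pentagon ⊆ Metric.closedBall (0 : ℂ) 2 :=
    pentagon_subset.trans (Metric.closedBall_subset_closedBall (by norm_num))
  have h2 := goldenRatio_smul_pentagon_subset
  have h3 := neg_subset_closedBall h1
  have h4 := neg_subset_closedBall h2
  rcases hW with rfl | rfl <;> fin_cases j <;> simpa [pentagons, pentagons'] using by assumption

lemma pentagon_mem_nhds : pentagon ∈ nhds (0 : ℂ) := by
  have hconv : Convex ℝ pentagon := convex_convexHull ℝ _
  have hroot : ∀ k : ℕ, zeta5 ^ k ∈ pentagon := fun k => subset_convexHull ℝ _ (by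
    rw [Set.mem_ofPred_eq, ← pow_mul, mul_comm, pow_mul, zeta5_pow_five, one_pow])
  -- the average of the other four vertices is a negative multiple of a vertex
  have hneg : ∀ k : ℕ, (((-1 / 4 : ℝ) : ℂ)) * zeta5 ^ k ∈ pentagon := by
    intro k
    have h := hconv.sum_mem (t := Finset.univ) (w := fun _ : Fin 4 => (1 / 4 : ℝ))
      (z := fun i : Fin 4 => zeta5 ^ (k + 1 + (i : ℕ))) (by intros; norm_num) (by simp)
      (fun i _ => hroot _)
    convert h using 1
    simp [Fin.sum_univ_four]
    linear_combination (-(1 / 4) * zeta5 ^ k) * zeta5_pow_four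
  have hline : ∀ (k : ℕ) (r : ℝ), |r| < 1 / 4 → (r : ℂ) * zeta5 ^ k ∈ pentagon := by
    intro k r hr
    have hr' := abs_lt.1 hr
    have h := hconv (hneg k) (hroot k) (a := (4 / 5) * (1 - r)) (b := 1 - (4 / 5) * (1 - r))
      (by linarith) (by linarith) (by ring)
    convert h using 1
    simp only [Complex.real_smul]
    push_cast
    ring
  have hsub : {z : ℂ | |2 * coordS z| < 1 / 4 ∧ |2 * coordT z| < 1 / 4} ⊆ pentagon := by
    rintro z ⟨h1, h2⟩
    have h := hconv (hline 0 _ h1) (hline 1 _ h2) (a := 1 / 2) (b := 1 / 2) (by norm_num)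
      (by norm_num) (by norm_num)
    convert h using 1
    nth_rewrite 1 [coord_eq z]
    simp only [Complex.real_smul]
    push_cast
    ring
  have hT : Continuous coordT := by unfold coordT; fun_prop
  have hS : Continuous coordS := by unfold coordS; fun_prop
  refine Filter.mem_of_superset (IsOpen.mem_nhds ?_ ?_) hsub
  · exact (isOpen_lt (continuous_const.mul hS).abs continuous_const).inter
      (isOpen_lt (continuous_const.mul hT).abs continuous_const)
  · simp [coordS, coordT]

lemma mem_shiftedWindow_of_pentagon {W : Fin 4 → Set ℂ} (hW : W = pentagons ∨ W = pentagons')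
    {u y : ℂ} (h : y - u ∈ pentagon) : (y, (1 : ZMod 5)) ∈ shiftedWindow W u := by
  have h0 : W 0 = pentagon := by rcases hW with rfl | rfl <;> rfl
  refine ⟨(y - u, 1), ?_, by simp⟩
  rw [window, Set.mem_iUnion]
  exact ⟨0, by rw [h0]; exact h, by simp⟩

lemma norm_fst_le_of_mem_shiftedWindow {W : Fin 4 → Set ℂ}
    (hW : W = pentagons ∨ W = pentagons') {u : ℂ} {p : ℂ × ZMod 5}
    (h : p ∈ shiftedWindow W u) : ‖p.1‖ ≤ ‖u‖ + 2 := by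
  obtain ⟨q, hq, rfl⟩ := h
  rw [window, Set.mem_iUnion] at hq
  obtain ⟨j, hj⟩ := hq
  have h1 := mem_closedBall_zero_iff.1 (window_subset hW j hj.1)
  exact (norm_add_le u q.1).trans (by linarith)

/-- Penrose model sets are locally finite. -/
lemma finite_inter_closedBall {W : Fin 4 → Set ℂ} (hW : W = pentagons ∨ W = pentagons')
    (t u c : ℂ) (R : ℝ) :
    (((fun z => t + z) '' modelSet (shiftedWindow W u)) ∩ Metric.closedBall c R).Finite := by
  refine ((finite_coord (R + ‖c‖ + ‖t‖) (‖u‖ + 2)).image fun a => t + coordElt a).subset ?_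
  rintro _ ⟨⟨_, ⟨a, rfl, ha⟩, rfl⟩, hc⟩
  refine ⟨a, ⟨?_, norm_fst_le_of_mem_shiftedWindow hW ha⟩, rfl⟩
  rw [mem_closedBall_iff_norm] at hc
  calc ‖coordElt a‖ = ‖(t + coordElt a - c) + (c - t)‖ := by congr 1; ring
    _ ≤ ‖t + coordElt a - c‖ + ‖c - t‖ := norm_add_le _ _
    _ ≤ R + (‖c‖ + ‖t‖) := add_le_add hc (norm_sub_le _ _)
    _ = R + ‖c‖ + ‖t‖ := by ring

/-! ### Failure for three directions -/

/-- Every point of the plane is approximated up to `2 |g|` by the lattice spanned by `g` and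
`g ζ₅²`. -/
lemma exists_lattice_approx {g : ℝ} (hg : g ≠ 0) (y : ℂ) :
    ∃ k l : ℤ, ‖(g : ℂ) * (k + l * zeta5 ^ 2) - y‖ ≤ 2 * |g| := by
  have him : (zeta5 ^ 2).im ≠ 0 := by
    have h2 : zeta5 ^ 2 = Complex.exp ((Real.pi - Real.pi / 5 : ℝ) * Complex.I) := by
      rw [zeta5, ← Complex.exp_nat_mul]; congr 1; push_cast; ring
    rw [h2, Complex.exp_ofReal_mul_I_im, Real.sin_pi_sub]
    have := Real.pi_pos
    exact (Real.sin_pos_of_pos_of_lt_pi (by positivity) (by linarith)).ne'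
  set y' := y / g with hy'
  set t := y'.im / (zeta5 ^ 2).im with ht
  set s := y'.re - t * (zeta5 ^ 2).re with hs
  have hy : y' = s + t * zeta5 ^ 2 := by
    apply Complex.ext
    · rw [Complex.add_re, Complex.re_ofReal_mul, Complex.ofReal_re, hs]; ring
    · rw [Complex.add_im, Complex.im_ofReal_mul, Complex.ofReal_im, ht]; field_simp; ring
  have hg' : (g : ℂ) ≠ 0 := by exact_mod_cast hg
  refine ⟨⌊s⌋, ⌊t⌋, ?_⟩
  have h1 : (g : ℂ) * (⌊s⌋ + ⌊t⌋ * zeta5 ^ 2) - y =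
      g * (-((Int.fract s : ℝ) : ℂ) - (Int.fract t : ℝ) * zeta5 ^ 2) := by
    have h2 : y = g * (s + t * zeta5 ^ 2) := by rw [← hy, hy']; field_simp
    rw [h2, Int.fract, Int.fract]
    push_cast
    ring
  rw [h1, norm_mul, Complex.norm_real, Real.norm_eq_abs, mul_comm]
  refine mul_le_mul_of_nonneg_right ((norm_sub_le _ _).trans ?_) (abs_nonneg g)
  rw [norm_neg, norm_mul, norm_zeta5_pow, Complex.norm_real, Complex.norm_real, Real.norm_eq_abs,
    Real.norm_eq_abs, abs_of_nonneg (Int.fract_nonneg s), abs_of_nonneg (Int.fract_nonneg t)]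
  linarith [Int.fract_lt_one s, Int.fract_lt_one t]

/-- The hexagon with vertices `c ± zᵢ` fits into every Penrose model set after scaling by
`5 τⁿ`. -/
lemma not_determined_of_sum_eq_zero {W : Fin 4 → Set ℂ} (hW : W = pentagons ∨ W = pentagons')
    {Λ : Set ℂ} (hΛ : IsPenroseModelSet W Λ) {U : Set Circle} {z : Fin 3 → ℂ}
    (hz : ∀ i, z i ∈ Zzeta5) (hsum : z 0 + z 1 + z 2 = 0) (hcross : cross (z 0) (z 1) ≠ 0)
    (hU : ∀ u ∈ U, ∃ i, Parallel (u : ℂ) (z i)) : ¬ Determined (convexSubsets Λ) U := by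
  obtain ⟨t, u, -, rfl⟩ := hΛ
  obtain ⟨r, hr, hball⟩ := Metric.mem_nhds_iff.1 pentagon_mem_nhds
  choose b hb using fun i => exists_coord (hz i)
  set S := ‖sigma (b 0)‖ + ‖sigma (b 1)‖ + ‖sigma (b 2)‖ with hS
  have hSi : ∀ i, ‖sigma (b i)‖ ≤ S := by
    have h0 := norm_nonneg (sigma (b 0))
    have h1 := norm_nonneg (sigma (b 1))
    have h2 := norm_nonneg (sigma (b 2))
    intro i
    fin_cases i <;> simp [hS] <;> linarith
  have hS0 : 0 ≤ S := (norm_nonneg _).trans (hSi 0)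
  obtain ⟨n, hn⟩ : ∃ n : ℕ, |5 * Real.goldenConj ^ n| * (2 + S) < r := by
    have h1 : |Real.goldenConj| < 1 :=
      abs_lt.2 ⟨Real.neg_one_lt_goldenConj, Real.goldenConj_neg.trans one_pos⟩
    obtain ⟨n, hn⟩ := exists_pow_lt_of_lt_one (show 0 < r / (5 * (2 + S)) by positivity) h1
    refine ⟨n, ?_⟩
    rw [abs_mul, abs_pow, abs_of_pos (by norm_num : (0 : ℝ) < 5)]
    rw [lt_div_iff₀ (by positivity)] at hn
    linarith
  set g : ℝ := 5 * Real.goldenConj ^ n with hg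
  have hg0 : g ≠ 0 := mul_ne_zero (by norm_num) (pow_ne_zero _ Real.goldenConj_ne_zero)
  have hscale : ∀ a : Fin 4 → ℤ, ∃ a' : Fin 4 → ℤ,
      coordElt a' = ((5 * Real.goldenRatio ^ n : ℝ) : ℂ) * coordElt a ∧ sigma a' = g * sigma a ∧
        kappa a' = 0 := by
    intro a
    obtain ⟨a', h1, h2⟩ := exists_goldenRatio_pow_mul n a
    refine ⟨(5 : ℤ) • a', ?_, ?_, ?_⟩
    · rw [coordElt_smul, h1]; push_cast; ring
    · rw [sigma_smul, h2, hg]; push_cast; ring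
    · rw [kappa_smul, show ((5 : ℤ) : ZMod 5) = 0 from rfl, zero_mul]
  obtain ⟨k, l, hkl⟩ := exists_lattice_approx hg0 (u - 1)
  obtain ⟨w', -, hw1, hw2⟩ := hscale ![k, l, 0, 0]
  have hw3 : sigma ![k, l, 0, 0] = k + l * zeta5 ^ 2 := by simp [sigma, Fin.sum_univ_four]
  set w : Fin 4 → ℤ := ![1, 0, 0, 0] + w' with hw
  have hwσ : ‖sigma w - u‖ ≤ 2 * |g| := by
    have h1 : sigma ![1, 0, 0, 0] = 1 := by simp [sigma, Fin.sum_univ_four]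
    have h2 : sigma w - u = g * (k + l * zeta5 ^ 2) - (u - 1) := by
      rw [hw, sigma_add, hw1, hw3, h1]; ring
    rw [h2]
    exact hkl
  have hwκ : kappa w = 1 := by
    rw [hw, kappa_add, hw2]
    simp [kappa, Fin.sum_univ_four]
  choose b' hb1 hb2 hb3 using fun i => hscale (b i)
  set T : ℝ := 5 * Real.goldenRatio ^ n with hT
  have hT0 : T ≠ 0 := mul_ne_zero (by norm_num) (pow_ne_zero _ Real.goldenRatio_ne_zero)
  have hmem : ∀ (i : Fin 3) (m : ℤ), |m| = 1 → t + coordElt w + m * ((T : ℂ) * z i) ∈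
      (fun z => t + z) '' modelSet (shiftedWindow W u) := by
    intro i m hm
    refine ⟨coordElt (w + m • b' i), ⟨_, rfl, ?_⟩, ?_⟩
    · rw [starMap_eq, kappa_add, kappa_smul, hb3, hwκ, mul_zero, add_zero]
      apply mem_shiftedWindow_of_pentagon hW
      apply hball
      rw [mem_ball_zero_iff, sigma_add, sigma_smul, hb2]
      have hm' : ‖(m : ℂ)‖ = 1 := by rw [Complex.norm_intCast]; exact_mod_cast hm
      calc ‖sigma w + m * (g * sigma (b i)) - u‖
          = ‖(sigma w - u) + m * (g * sigma (b i))‖ := by congr 1; ring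
        _ ≤ ‖sigma w - u‖ + ‖(m : ℂ) * (g * sigma (b i))‖ := norm_add_le _ _
        _ = ‖sigma w - u‖ + |g| * ‖sigma (b i)‖ := by
          rw [norm_mul, hm', one_mul, norm_mul, Complex.norm_real, Real.norm_eq_abs]
        _ ≤ 2 * |g| + |g| * S :=
          add_le_add hwσ (mul_le_mul_of_nonneg_left (hSi i) (abs_nonneg g))
        _ = |g| * (2 + S) := by ring
        _ < r := hn
    · rw [coordElt_add, coordElt_smul, hb1, hb]; ring
  refine not_determined_of_hexagon (c := t + coordElt w) (z := fun i => (T : ℂ) * z i) ?_ ?_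
    (fun R => finite_inter_closedBall hW t u _ R) (fun i => ?_) (fun i => ?_) fun v hv => ?_
  · linear_combination (T : ℂ) * hsum
  · rw [cross_real_mul]
    exact mul_ne_zero (mul_ne_zero hT0 hT0) hcross
  · simpa using hmem i 1 (by norm_num)
  · simpa [sub_eq_add_neg] using hmem i (-1) (by norm_num)
  · obtain ⟨i, hi⟩ := hU v hv
    exact ⟨i, hi.trans (parallel_real_mul hT0 _)⟩

lemma conj_mem {z : ℂ} (hz : z ∈ Zzeta5) : (starRingEnd ℂ) z ∈ Zzeta5 := by
  obtain ⟨a, rfl⟩ := exists_coord hz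
  rw [coordElt, map_sum]
  refine sum_mem fun j _ => ?_
  rw [map_mul, map_intCast, map_pow, conj_zeta5]
  exact mul_mem (intCast_mem _ _) (pow_mem (pow_mem zeta5_mem 4) _)

/-- A suitable real multiple of the signed area lies in `ℤ[ζ₅]`. -/
lemma cross_mem {a b : ℂ} (ha : a ∈ Zzeta5) (hb : b ∈ Zzeta5) :
    ((4 * zeta5.im * cross a b : ℝ) : ℂ) ∈ Zzeta5 := by
  have h : ((4 * zeta5.im * cross a b : ℝ) : ℂ) = (zeta5 - (starRingEnd ℂ) zeta5) *
      (a * (starRingEnd ℂ) b - (starRingEnd ℂ) a * b) := by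
    apply Complex.ext
    · simp [cross_apply]; ring
    · simp [cross_apply]
  rw [h]
  exact mul_mem (sub_mem zeta5_mem (conj_mem zeta5_mem))
    (sub_mem (mul_mem ha (conj_mem hb)) (mul_mem (conj_mem ha) hb))

/-- Up to three directions are the side directions of a triangle with sides in `ℤ[ζ₅]`. -/
lemma exists_sum_eq_zero {U : Set Circle} (hcard : U.encard ≤ 3)
    (hU : NonparallelZzeta5Directions U) : ∃ z : Fin 3 → ℂ, (∀ i, z i ∈ Zzeta5) ∧
      z 0 + z 1 + z 2 = 0 ∧ cross (z 0) (z 1) ≠ 0 ∧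
        ∀ u ∈ U, ∃ i, Parallel (u : ℂ) (z i) := by
  obtain ⟨hdir, hpar⟩ := hU
  have hcross : ∀ {u v : Circle} {a b : ℂ}, u ∈ U → v ∈ U → u ≠ v → a ≠ 0 → b ≠ 0 →
      Parallel u a → Parallel v b → cross a b ≠ 0 := by
    intro u v a b hu hv huv ha hb hua hvb h0
    exact hpar hu hv huv ((hua.trans (parallel_of_cross_eq_zero ha hb h0)).trans hvb.symm)
  have hself : ∀ a : ℂ, a ≠ 0 → cross a (zeta5 * a) ≠ 0 := by
    intro a ha
    have h : cross a (zeta5 * a) = zeta5.im * Complex.normSq a := by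
      simp [cross_apply, Complex.normSq_apply]; ring
    rw [h]
    exact mul_ne_zero zeta5_im_pos.ne' (Complex.normSq_pos.2 ha).ne'
  -- two vectors are completed to a triangle
  have htwo : ∀ a b : ℂ, a ∈ Zzeta5 → b ∈ Zzeta5 → cross a b ≠ 0 →
      (∀ u ∈ U, Parallel (u : ℂ) a ∨ Parallel (u : ℂ) b) → ∃ z : Fin 3 → ℂ,
        (∀ i, z i ∈ Zzeta5) ∧ z 0 + z 1 + z 2 = 0 ∧ cross (z 0) (z 1) ≠ 0 ∧
          ∀ u ∈ U, ∃ i, Parallel (u : ℂ) (z i) := by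
    intro a b ha hb hab h
    refine ⟨![a, b, -a - b], fun i => ?_, by simp, hab, fun u hu => ?_⟩
    · fin_cases i
      exacts [ha, hb, sub_mem (neg_mem ha) hb]
    · rcases h u hu with h | h
      exacts [⟨0, h⟩, ⟨1, h⟩]
  have hfin : U.Finite := Set.finite_of_encard_le_coe (k := 3) hcard
  have hcases : U.encard = 0 ∨ U.encard = 1 ∨ U.encard = 2 ∨ U.encard = 3 := by
    rw [← hfin.cast_ncard_eq] at hcard ⊢
    have : U.ncard ≤ 3 := by exact_mod_cast hcard
    generalize U.ncard = n at this
    interval_cases n <;> simp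
  rcases hcases with h | h | h | h
  · rw [Set.encard_eq_zero] at h
    subst h
    exact htwo 1 (zeta5 * 1) (one_mem _) (mul_mem zeta5_mem (one_mem _)) (hself 1 one_ne_zero)
      (by simp)
  · obtain ⟨u, rfl⟩ := Set.encard_eq_one.1 h
    obtain ⟨a, ha, ha0, hua⟩ := hdir u rfl
    exact htwo a (zeta5 * a) ha (mul_mem zeta5_mem ha) (hself a ha0) (by simpa using Or.inl hua)
  · obtain ⟨u, v, huv, rfl⟩ := Set.encard_eq_two.1 h
    obtain ⟨a, ha, ha0, hua⟩ := hdir u (by simp)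
    obtain ⟨b, hb, hb0, hvb⟩ := hdir v (by simp)
    refine htwo a b ha hb (hcross (by simp) (by simp) huv ha0 hb0 hua hvb) ?_
    simp only [Set.mem_insert_iff, Set.mem_singleton_iff, forall_eq_or_imp, forall_eq]
    exact ⟨Or.inl hua, Or.inr hvb⟩
  · obtain ⟨u, v, w, huv, huw, hvw, rfl⟩ := Set.encard_eq_three.1 h
    obtain ⟨a, ha, ha0, hua⟩ := hdir u (by simp)
    obtain ⟨b, hb, hb0, hvb⟩ := hdir v (by simp)
    obtain ⟨c, hc, hc0, hwc⟩ := hdir w (by simp)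
    have hab := hcross (by simp) (by simp) huv ha0 hb0 hua hvb
    have hbc := hcross (by simp) (by simp) hvw hb0 hc0 hvb hwc
    have hca := hcross (by simp) (by simp) huw.symm hc0 ha0 hwc hua
    have h4 : 4 * zeta5.im ≠ 0 := mul_ne_zero (by norm_num) zeta5_im_pos.ne'
    have hα := mul_ne_zero h4 hbc
    have hβ := mul_ne_zero h4 hca
    have hγ := mul_ne_zero h4 hab
    refine ⟨![((4 * zeta5.im * cross b c : ℝ) : ℂ) * a, ((4 * zeta5.im * cross c a : ℝ) : ℂ) * b,
      ((4 * zeta5.im * cross a b : ℝ) : ℂ) * c], fun i => ?_, ?_, ?_, ?_⟩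
    · fin_cases i
      exacts [mul_mem (cross_mem hb hc) ha, mul_mem (cross_mem hc ha) hb,
        mul_mem (cross_mem ha hb) hc]
    · apply Complex.ext <;> (simp [cross_apply]; ring)
    · change cross (((4 * zeta5.im * cross b c : ℝ) : ℂ) * a)
        (((4 * zeta5.im * cross c a : ℝ) : ℂ) * b) ≠ 0
      rw [cross_real_mul]
      exact mul_ne_zero (mul_ne_zero hα hβ) hab
    · simp only [Set.mem_insert_iff, Set.mem_singleton_iff, forall_eq_or_imp, forall_eq]
      exact ⟨⟨0, hua.trans (parallel_real_mul hα a)⟩, ⟨1, hvb.trans (parallel_real_mul hβ b)⟩,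
        ⟨2, hwc.trans (parallel_real_mul hγ c)⟩⟩

end Penrose

open Penrose in
theorem theorem4p8 :
    -- existence of four directions that work for all Penrose model sets,
    (∃ U : Set Circle, U.encard = 4 ∧ NonparallelZzeta5Directions U ∧
      ∀ W : Fin 4 → Set ℂ, W = pentagons ∨ W = pentagons' →
        ∀ Λ : Set ℂ, IsPenroseModelSet W Λ → Determined (convexSubsets Λ) U) ∧
    -- an explicit example of such a set of directions,
    (fourDirections.encard = 4 ∧ NonparallelZzeta5Directions fourDirections ∧
      ∀ W : Fin 4 → Set ℂ, W = pentagons ∨ W = pentagons' →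
        ∀ Λ : Set ℂ, IsPenroseModelSet W Λ →
          Determined (convexSubsets Λ) fourDirections) ∧
    -- and the failure for three or fewer directions.
    (∀ W : Fin 4 → Set ℂ, W = pentagons ∨ W = pentagons' →
      ∀ Λ : Set ℂ, IsPenroseModelSet W Λ →
        ∀ U : Set Circle, U.encard ≤ 3 → NonparallelZzeta5Directions U →
          ¬ Determined (convexSubsets Λ) U) := by
  have hfour : fourDirections.encard = 4 ∧ NonparallelZzeta5Directions fourDirections ∧
      ∀ W : Fin 4 → Set ℂ, W = pentagons ∨ W = pentagons' →
        ∀ Λ : Set ℂ, IsPenroseModelSet W Λ → Determined (convexSubsets Λ) fourDirections :=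
    ⟨encard_fourDirections, nonparallel_fourDirections,
      fun _ _ Λ _ => determined_fourDirections Λ⟩
  refine ⟨⟨fourDirections, hfour⟩, hfour, fun W hW Λ hΛ U hcard hU => ?_⟩
  obtain ⟨z, hz, hsum, hcross, hpar⟩ := exists_sum_eq_zero hcard hU
  exact not_determined_of_sum_eq_zero hW hΛ hz hsum hcross hpar
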